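/- **Corollary 3.7 (basis).** Let $n\ge 1$, let $W_n=\mathrm{Der}\,\mathbb C[t_1,\dots,t_n]$, $\partial_i=\partial/\partial t_i$, $h_i=t_i\partial_i$, and let $U_\partial$ be the localization of the universal enveloping algebra $U(W_n)$ at the Ore set $\{\partial_1^{i_1}\cdots\partial_n^{i_n}\mid i_1,\dots,i_n\in\mathbb Z_{\ge0}\}$. Let $$H_n=\{u\in U_\partial\mid [u,\partial_i]=[u,h_i]=0,\ i=1,\dots,n\}.$$ For $\mathbf m\in\mathbb Z_{\ge0}^n$ write $|\mathbf m|=m_1+\dots+m_n$ and $t^{\mathbf m}=t_1^{m_1}\cdots t_n^{m_n}$; for $\mathbf a\in\mathbb Z^n$ write $\partial^{\mathbf a}=\partial_1^{a_1}\cdots\partial_n^{a_n}\in U_\partial$; let $\mathbf e_1,\dots,\mathbf e_n$ be the standard basis of $\mathbb Z^n$. Let $I$ be the set of pairs $(\mathbf m,j)$ with $\mathbf m\in\mathbb Z_{\ge0}^n$, $j\in\{1,\dots,n\}$, $|\mathbf m|\ge1$ and $\mathbf m\ne\mathbf e_j$. Then there are elements $X_{\mathbf m,j}\in H_n$, $(\mathbf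 m,j)\in I$, of the form $$X_{\mathbf m,j}=(t^{\mathbf m}\partial_j)\,\partial^{\mathbf m-\mathbf e_j}+\sum_{0\le|\mathbf r|<|\mathbf m|}(t^{\mathbf r}\partial_j)\,g_{\mathbf r}(h)\,\partial^{\mathbf r-\mathbf e_j},\qquad(*)$$ where each $g_{\mathbf r}(h)$ is a polynomial in $h_1,\dots,h_n$ of degree at most $|\mathbf m|-|\mathbf r|$ (depending on $\mathbf m,j$). Moreover, for every family $(X_{\mathbf m,j})_{(\mathbf m,j)\in I}$ of elements of $H_n$ of the form $(*)$ and every total order on $I$, the ordered monomials $$X_{i_1}^{s_1}X_{i_2}^{s_2}\cdots X_{i_k}^{s_k},\qquad k\ge0,\quad i_1<\dots<i_k\text{ in }I,\quad s_1,\dots,s_k\ge1,$$ are pairwise distinct and form a basis of the complex vector space $H_n$. -/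

import Mathlib

namespace WittLoc

/-- `W_n = Der ℂ[t_1, …, t_n]`, with the commutator bracket of derivations. -/
abbrev W (n : ℕ) : Type :=
  Derivation ℂ (MvPolynomial (Fin n) ℂ) (MvPolynomial (Fin n) ℂ)

/-- The vector field `t^m ∂_j` in `W_n`. -/
noncomputable def vf {n : ℕ} (m : Fin n →₀ ℕ) (j : Fin n) : W n :=
  MvPolynomial.monomial m (1 : ℂ) • MvPolynomial.pderiv j

/-- `U = U(W_n)`. -/
abbrev U (n : ℕ) : Type := UniversalEnvelopingAlgebra ℂ (W n)

/-- `∂_i` as an element of `U(W_n)`. -/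
noncomputable def del {n : ℕ} (i : Fin n) : U n :=
  UniversalEnvelopingAlgebra.ι ℂ (MvPolynomial.pderiv i : W n)

/-- The multiplicative subset `{∂_1^{i_1} ⋯ ∂_n^{i_n}}` of `U(W_n)`. -/
noncomputable def delMonoid (n : ℕ) : Submonoid (U n) :=
  Submonoid.closure (Set.range (del (n := n)))

/-! ### The set `delMonoid n` is an Ore set -/

/-- For an additive map `D` satisfying the Leibniz rule, locally nilpotent elements are closed
under products. -/
theorem leibniz_iterate {R : Type*} [Ring R] (D : R →+ R)
    (hD : ∀ a b, D (a * b) = D a * b + a * D b) (K : ℕ) :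
    ∀ (N M : ℕ) (a b : R), N + M = K → D^[N] a = 0 → D^[M] b = 0 → D^[K] (a * b) = 0 := by
  have hz : ∀ k : ℕ, D^[k] 0 = 0 := fun k => iterate_map_zero D k
  induction K with
  | zero =>
    intro N M a b h ha hb
    obtain ⟨rfl, rfl⟩ : N = 0 ∧ M = 0 := by omega
    simp only [Function.iterate_zero, id_eq] at ha ⊢
    simp [ha]
  | succ K ih =>
    intro N M a b h ha hb
    rcases N with _ | N
    · simp only [Function.iterate_zero, id_eq] at ha
      rw [ha, zero_mul, hz]
    rcases M with _ | M
    · simp only [Function.iterate_zero, id_eq] at hb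
      rw [hb, mul_zero, hz]
    rw [Function.iterate_succ_apply, hD, iterate_map_add,
      ih N (M + 1) (D a) b (by omega) ha hb, ih (N + 1) M a (D b) (by omega) ha hb, add_zero]

theorem iterate_eq_zero_of_le {R : Type*} [Ring R] (D : R →+ R) {N M : ℕ} (h : N ≤ M) {a : R}
    (ha : D^[N] a = 0) : D^[M] a = 0 := by
  obtain ⟨k, rfl⟩ := Nat.exists_eq_add_of_le h
  rw [add_comm, Function.iterate_add_apply, ha, iterate_map_zero]

/-- `ad d` as an additive map. -/
def adHom {R : Type*} [Ring R] (d : R) : R →+ R where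
  toFun r := d * r - r * d
  map_zero' := by simp
  map_add' a b := by rw [mul_add, add_mul]; abel

theorem adHom_apply {R : Type*} [Ring R] (d r : R) : adHom d r = d * r - r * d := rfl

theorem adHom_mul {R : Type*} [Ring R] (d a b : R) :
    adHom d (a * b) = adHom d a * b + a * adHom d b := by
  simp only [adHom_apply]; noncomm_ring

theorem ore_of_ad_nilpotent {R : Type*} [Ring R] (d : R) (N : ℕ) :
    ∀ r : R, (adHom d)^[N] r = 0 → ∃ (k : ℕ) (r' : R), d ^ k * r = r' * d := by
  induction N with
  | zero => intro r h; exact ⟨0, 0, by simpa using h⟩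
  | succ N ih =>
    intro r h
    obtain ⟨k, r', hk⟩ := ih _ ((Function.iterate_succ_apply _ _ _).symm.trans h)
    refine ⟨k + 1, r' + d ^ k * r, ?_⟩
    rw [adHom_apply, mul_sub] at hk
    rw [add_mul, ← hk, pow_succ]
    noncomm_ring

theorem cancel_of_ad_nilpotent {R : Type*} [Ring R] (d : R) (N : ℕ) :
    ∀ r : R, (adHom d)^[N] r = 0 → r * d = 0 → ∃ k : ℕ, d ^ k * r = 0 := by
  induction N with
  | zero => intro r h _; exact ⟨0, by simpa using h⟩
  | succ N ih =>
    intro r h hr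
    have h1 : adHom d r = d * r := by rw [adHom_apply, hr, sub_zero]
    obtain ⟨k, hk⟩ := ih _ ((Function.iterate_succ_apply _ _ _).symm.trans h)
      (by rw [h1, mul_assoc, hr, mul_zero])
    exact ⟨k + 1, by rw [pow_succ, mul_assoc, ← h1, hk]⟩

/-- A multiplicative set generated by locally ad-nilpotent elements is an Ore set. -/
theorem nonempty_oreSet_closure {R : Type*} [Ring R] (G : Set R)
    (hG : ∀ d ∈ G, ∀ r : R, ∃ N : ℕ, (adHom d)^[N] r = 0) :
    Nonempty (OreLocalization.OreSet (Submonoid.closure G)) := by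
  rw [OreLocalization.nonempty_oreSet_iff]
  constructor
  · have key : ∀ s ∈ Submonoid.closure G, ∀ r : R, r * s = 0 →
        ∃ s' ∈ Submonoid.closure G, s' * r = 0 := by
      intro s hs
      induction hs using Submonoid.closure_induction with
      | mem d hd =>
        intro r hr
        obtain ⟨N, hN⟩ := hG d hd r
        obtain ⟨k, hk⟩ := cancel_of_ad_nilpotent d N r hN hr
        exact ⟨d ^ k, pow_mem (Submonoid.subset_closure hd) k, hk⟩
      | one => intro r hr; exact ⟨1, one_mem _, by simpa using hr⟩
      | mul x y _ _ hx hy =>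
        intro r hr
        obtain ⟨s₂, h₂, e₂⟩ := hy (r * x) (by rw [mul_assoc, hr])
        obtain ⟨s₁, h₁, e₁⟩ := hx (s₂ * r) (by rw [mul_assoc, e₂])
        exact ⟨s₁ * s₂, mul_mem h₁ h₂, by rw [mul_assoc, e₁]⟩
    intro r₁ r₂ s h
    obtain ⟨s', hs', e⟩ := key s s.2 (r₁ - r₂) (by rw [sub_mul, h, sub_self])
    exact ⟨⟨s', hs'⟩, by rw [mul_sub] at e; exact sub_eq_zero.mp e⟩
  · have key : ∀ s ∈ Submonoid.closure G, ∀ r : R,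
        ∃ r' : R, ∃ s' ∈ Submonoid.closure G, s' * r = r' * s := by
      intro s hs
      induction hs using Submonoid.closure_induction with
      | mem d hd =>
        intro r
        obtain ⟨N, hN⟩ := hG d hd r
        obtain ⟨k, r', hk⟩ := ore_of_ad_nilpotent d N r hN
        exact ⟨r', d ^ k, pow_mem (Submonoid.subset_closure hd) k, hk⟩
      | one => intro r; exact ⟨r, 1, one_mem _, by simp⟩
      | mul x y _ _ hx hy =>
        intro r
        obtain ⟨r₂, s₂, h₂, e₂⟩ := hy r
        obtain ⟨r₁, s₁, h₁, e₁⟩ := hx r₂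
        exact ⟨r₁, s₁ * s₂, mul_mem h₁ h₂, by rw [mul_assoc, e₂, ← mul_assoc, e₁, mul_assoc]⟩
    intro r s
    obtain ⟨r', s', hs', e⟩ := key s s.2 r
    exact ⟨r', ⟨s', hs'⟩, e⟩

theorem pderiv_locally_nilpotent {n : ℕ} (i : Fin n) (f : MvPolynomial (Fin n) ℂ) :
    ∃ N : ℕ, (MvPolynomial.pderiv i : W n)^[N] f = 0 := by
  set D : MvPolynomial (Fin n) ℂ →+ MvPolynomial (Fin n) ℂ :=
    ((MvPolynomial.pderiv i : W n) : _ →ₗ[ℂ] _).toAddMonoidHom with hD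
  have hD' : ∀ a, D a = (MvPolynomial.pderiv i : W n) a := fun _ => rfl
  have hmul : ∀ a b, D (a * b) = D a * b + a * D b := by
    intro a b
    simp only [hD', Derivation.leibniz, smul_eq_mul]; ring
  change ∃ N : ℕ, D^[N] f = 0
  induction f using MvPolynomial.induction_on with
  | C a => exact ⟨1, by simp [hD']⟩
  | add p q hp hq =>
    obtain ⟨N, hN⟩ := hp
    obtain ⟨M, hM⟩ := hq
    refine ⟨N + M, ?_⟩
    rw [iterate_map_add, iterate_eq_zero_of_le D (Nat.le_add_right N M) hN,
      iterate_eq_zero_of_le D (Nat.le_add_left M N) hM, add_zero]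
  | mul_X p j hp =>
    obtain ⟨N, hN⟩ := hp
    refine ⟨N + 2, leibniz_iterate D hmul (N + 2) N 2 p _ rfl hN ?_⟩
    simp only [Function.iterate_succ, Function.iterate_zero, Function.comp_apply, id_eq, hD',
      MvPolynomial.pderiv_X]
    rcases eq_or_ne j i with rfl | h
    · simp
    · simp [Pi.single_eq_of_ne h]

/-- The bracket with `∂_i` on `W_n` is locally nilpotent. -/
theorem ad_pderiv_locally_nilpotent {n : ℕ} (i : Fin n) (x : W n) :
    ∃ N : ℕ, (fun y : W n => ⁅(MvPolynomial.pderiv i : W n), y⁆)^[N] x = 0 := by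
  have hcoef : ∀ (N : ℕ) (x : W n) (j : Fin n),
      ((fun y : W n => ⁅(MvPolynomial.pderiv i : W n), y⁆)^[N] x) (MvPolynomial.X j) =
        (MvPolynomial.pderiv i : W n)^[N] (x (MvPolynomial.X j)) := by
    intro N
    induction N with
    | zero => intro x j; rfl
    | succ N ih =>
      intro x j
      rw [Function.iterate_succ_apply, Function.iterate_succ_apply, ih,
        Derivation.commutator_apply]
      congr 1
      rw [MvPolynomial.pderiv_X]
      rcases eq_or_ne j i with rfl | h
      · simp
      · simp [Pi.single_eq_of_ne h]
  choose N hN using fun j : Fin n => pderiv_locally_nilpotent i (x (MvPolynomial.X j))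
  refine ⟨∑ j, N j, MvPolynomial.derivation_ext fun j => ?_⟩
  rw [hcoef, Derivation.zero_apply]
  exact iterate_eq_zero_of_le (((MvPolynomial.pderiv i : W n) :
    MvPolynomial (Fin n) ℂ →ₗ[ℂ] MvPolynomial (Fin n) ℂ).toAddMonoidHom)
    (Finset.single_le_sum (f := N) (fun _ _ => Nat.zero_le _) (Finset.mem_univ j)) (hN j)

theorem del_mul_sub {n : ℕ} (i : Fin n) (x : W n) :
    adHom (del i) (UniversalEnvelopingAlgebra.ι ℂ x) =
      UniversalEnvelopingAlgebra.ι ℂ ⁅(MvPolynomial.pderiv i : W n), x⁆ := by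
  let _ : LieRing (U n) := LieRing.ofAssociativeRing
  rw [LieHom.map_lie, LieRing.of_associative_ring_bracket]; rfl

theorem ad_del_locally_nilpotent {n : ℕ} (i : Fin n) (u : U n) :
    ∃ N : ℕ, (adHom (del i))^[N] u = 0 := by
  obtain ⟨a, rfl⟩ : ∃ a, UniversalEnvelopingAlgebra.mkAlgHom ℂ (W n) a = u :=
    RingCon.mk'_surjective (UniversalEnvelopingAlgebra.ringCon ℂ (W n)) u
  have hadd : ∀ p q : U n, (∃ N : ℕ, (adHom (del i))^[N] p = 0) →
      (∃ N : ℕ, (adHom (del i))^[N] q = 0) → ∃ N : ℕ, (adHom (del i))^[N] (p + q) = 0 := by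
    rintro p q ⟨N, hN⟩ ⟨M, hM⟩
    refine ⟨N + M, ?_⟩
    rw [iterate_map_add, iterate_eq_zero_of_le _ (Nat.le_add_right N M) hN,
      iterate_eq_zero_of_le _ (Nat.le_add_left M N) hM, add_zero]
  induction a using TensorAlgebra.induction with
  | algebraMap r =>
    refine ⟨1, ?_⟩
    simp only [Function.iterate_one, adHom_apply, AlgHom.commutes]
    rw [Algebra.commutes, sub_self]
  | ι x =>
    obtain ⟨N, hN⟩ := ad_pderiv_locally_nilpotent i x
    refine ⟨N, ?_⟩
    have : ∀ (N : ℕ) (x : W n), (adHom (del i))^[N] (UniversalEnvelopingAlgebra.ι ℂ x) =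
        UniversalEnvelopingAlgebra.ι ℂ
          ((fun y : W n => ⁅(MvPolynomial.pderiv i : W n), y⁆)^[N] x) := by
      intro N
      induction N with
      | zero => intro x; rfl
      | succ N ih =>
        intro x
        rw [Function.iterate_succ_apply, Function.iterate_succ_apply, del_mul_sub, ih]
    have h := this N x
    rw [hN] at h
    exact h.trans (by rw [UniversalEnvelopingAlgebra.ι_apply, map_zero, map_zero])
  | mul a b ha hb =>
    obtain ⟨N, hN⟩ := ha
    obtain ⟨M, hM⟩ := hb
    exact ⟨N + M, by
      rw [map_mul]
      exact leibniz_iterate _ (adHom_mul _) (N + M) N M _ _ rfl hN hM⟩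
  | add a b ha hb => rw [map_add]; exact hadd _ _ ha hb

noncomputable instance delOreSet (n : ℕ) : OreLocalization.OreSet (delMonoid n) :=
  Classical.choice (nonempty_oreSet_closure _ (by
    rintro _ ⟨i, rfl⟩ r
    exact ad_del_locally_nilpotent i r))

/-! ### The localization and the centralizer -/

/-- `U_∂`, the Ore localization of `U(W_n)` at `delMonoid n`. -/
abbrev Uloc (n : ℕ) : Type := OreLocalization (delMonoid n) (U n)

/-- The canonical map `W_n → U(W_n) → U_∂`. -/
noncomputable def toUloc {n : ℕ} (x : W n) : Uloc n :=
  OreLocalization.numeratorHom (UniversalEnvelopingAlgebra.ι ℂ x)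

/-- `∂_i` as an invertible element of `U_∂`. -/
noncomputable def delUnit {n : ℕ} (i : Fin n) : (Uloc n)ˣ :=
  OreLocalization.numeratorUnit
    (⟨del i, Submonoid.subset_closure ⟨i, rfl⟩⟩ : delMonoid n)

/-- `∂^a = ∂_1^{a_1} ⋯ ∂_n^{a_n}` in `U_∂`, for `a ∈ ℤ^n`. -/
noncomputable def delPow {n : ℕ} (a : Fin n → ℤ) : Uloc n :=
  ((List.ofFn fun i => delUnit i ^ a i).prod : (Uloc n)ˣ)

/-- `h_i = t_i ∂_i` in `U_∂`. -/
noncomputable def hElt {n : ℕ} (i : Fin n) : Uloc n :=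
  toUloc (vf (Finsupp.single i 1) i)

/-- The value `g(h_1, …, h_n)` in `U_∂` of a polynomial `g` (the `h_i` commute). -/
noncomputable def polyH {n : ℕ} (g : MvPolynomial (Fin n) ℂ) : Uloc n :=
  ∑ s ∈ g.support, g.coeff s • (List.ofFn fun i => hElt i ^ s i).prod

/-- `H_n = {u ∈ U_∂ | [u, ∂_i] = [u, h_i] = 0 for all i}`. -/
noncomputable def H (n : ℕ) : Subalgebra ℂ (Uloc n) :=
  Subalgebra.centralizer ℂ
    (Set.range (fun i : Fin n => (delUnit i : Uloc n)) ∪ Set.range (hElt (n := n)))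

/-! ### The generators and their ordered monomials -/

/-- The pairs `(m, j)` with `|m| ≥ 1` and `m ≠ e_j`. -/
def Idx (n : ℕ) : Type :=
  {p : (Fin n →₀ ℕ) × Fin n // 1 ≤ p.1.degree ∧ p.1 ≠ Finsupp.single p.2 1}

/-- The element `(t^r ∂_j) g(h) ∂^{r - e_j}` of `U_∂`. -/
noncomputable def term {n : ℕ} (r : Fin n →₀ ℕ) (j : Fin n) (g : MvPolynomial (Fin n) ℂ) :
    Uloc n :=
  toUloc (vf r j) * polyH g * delPow fun k => (r k : ℤ) - (Finsupp.single j 1 k : ℕ)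

/-- `x = (t^m ∂_j) ∂^{m - e_j} + ∑_{0 ≤ |r| < |m|} (t^r ∂_j) g_r(h) ∂^{r - e_j}` for some
polynomials `g_r` of degree at most `|m| - |r|`. -/
def HasLeadingTerm {n : ℕ} (m : Fin n →₀ ℕ) (j : Fin n) (x : Uloc n) : Prop :=
  ∃ g : (Fin n →₀ ℕ) → MvPolynomial (Fin n) ℂ,
    (∀ r, r.degree < m.degree → (g r).totalDegree ≤ m.degree - r.degree) ∧
    x = toUloc (vf m j) * (delPow fun k => (m k : ℤ) - (Finsupp.single j 1 k : ℕ)) +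
      ∑ d ∈ Finset.range m.degree, ∑ r ∈ Finset.univ.finsuppAntidiag d, term r j (g r)

/-- The ordered monomial `X_{i_1}^{s_{i_1}} ⋯ X_{i_k}^{s_{i_k}}`, where `i_1 < ⋯ < i_k` are the
indices at which `s` does not vanish. -/
def orderedMonomial {ι A : Type*} [LinearOrder ι] [Monoid A] (X : ι → A) (s : ι →₀ ℕ) : A :=
  ((s.support.sort (· ≤ ·)).map fun i => X i ^ s i).prod

end WittLoc

/-! Put T_i = h_i ∂_i⁻¹. The T_i commute with each other and [∂_i, T_j] = δ_ij, so U_∂ contains a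
Weyl algebra with invertible ∂_i, and every element of H_n commutes with it. The proof treats U_∂ as
H_n times this algebra.

Existence. In formal variables z, ad ∂_i multiplies ∑ z^r t^r∂_j / r! by z_i and ∑ z^q (-T)^q / q!
by -z_i, so it kills the product. The coefficient of z^m, times m! and ∂^(m - e_j), also has weight
zero under every h_i, hence lies in H_n; it has the form (*) because T^q ∂^q is a polynomial of
degree at most |q| in the h_i (`exists_mem_H_hasLeadingTerm`).

Spanning. Give t^m∂_j weight 1 and ∂_i⁻¹ weight -1. Commutators drop the weight, and X_{m,j} has
weight at most |m|. Solving (*) for t^m∂_j, by induction on |m|, writes each element of weight d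
through products c T^b ∂^a, where c is a combination of words in the X of |m|-weight at most d -
|a|. For an element of H_n, commuting with ∂_i removes the powers of T_i and commuting with h_i then
removes those of ∂_i (`mem_of_mem_colFil`). Applied to [X_p, X_q], this shows that the commutator is
a combination of words of weight below |m_p| + |m_q|, so words can be sorted.

Independence. Now give ∂_i and ∂_i⁻¹ weight 0, h_i weight 1 and every other t^m∂_j weight 2|m|. The
term of (*) with index r has weight at most 2|r| + (|m| - |r|) < 2|m|, so t^m∂_j ∂^(m - e_j) is the
leading term. The top part of a linear relation, after clearing denominators, becomes a relation in
U(W_n) between words that are not rearrangements of each other, modulo smaller weight. This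
contradicts the independence half of Poincaré–Birkhoff–Witt, which is proved with convolutions of
functionals dual to the letters (`linearIndependent_envWord`). -/

namespace WittLoc

/-! ### Filtrations by the weight of words -/

section LetterFiltration

variable {R ι A : Type*} [CommRing R] [Ring A] [Algebra R A]

/-- The span of all words in the letters `x i` whose total weight is at most `d`. -/
def letterFil (R : Type*) {ι A : Type*} [CommRing R] [Ring A] [Algebra R A] (x : ι → A)
    (w : ι → ℤ) (d : ℤ) : Submodule R A :=
  Submodule.span R {a | ∃ l : List ι, (l.map w).sum ≤ d ∧ (l.map x).prod = a}

variable {x : ι → A} {w : ι → ℤ}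

theorem prod_mem_letterFil (l : List ι) {d : ℤ} (h : (l.map w).sum ≤ d) :
    (l.map x).prod ∈ letterFil R x w d :=
  Submodule.subset_span ⟨l, h, rfl⟩

theorem letter_mem_letterFil (i : ι) {d : ℤ} (h : w i ≤ d) : x i ∈ letterFil R x w d := by
  simpa using prod_mem_letterFil (R := R) (x := x) (w := w) [i] (by simpa using h)

theorem one_mem_letterFil {d : ℤ} (h : 0 ≤ d) : (1 : A) ∈ letterFil R x w d := by
  simpa using prod_mem_letterFil (R := R) (x := x) (w := w) [] (by simpa using h)

theorem letterFil_mono {d e : ℤ} (h : d ≤ e) : letterFil R x w d ≤ letterFil R x w e :=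
  Submodule.span_mono fun _ ⟨l, hl, e⟩ => ⟨l, hl.trans h, e⟩

theorem mul_mem_letterFil {d e f : ℤ} {a b : A} (ha : a ∈ letterFil R x w d)
    (hb : b ∈ letterFil R x w e) (h : d + e ≤ f) : a * b ∈ letterFil R x w f := by
  induction ha using Submodule.span_induction with
  | mem a ha =>
    obtain ⟨l, hl, rfl⟩ := ha
    induction hb using Submodule.span_induction with
    | mem b hb =>
      obtain ⟨l', hl', rfl⟩ := hb
      rw [← List.prod_append, ← List.map_append]
      exact prod_mem_letterFil _ (by simp only [List.map_append, List.sum_append]; omega)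
    | zero => simp
    | add p q _ _ hp hq => rw [mul_add]; exact add_mem hp hq
    | smul c p _ hp => rw [mul_smul_comm]; exact Submodule.smul_mem _ _ hp
  | zero => simp
  | add p q _ _ hp hq => rw [add_mul]; exact add_mem hp hq
  | smul c p _ hp => rw [smul_mul_assoc]; exact Submodule.smul_mem _ _ hp

theorem commutator_mul_left (a b c : A) :
    a * b * c - c * (a * b) = a * (b * c - c * b) + (a * c - c * a) * b := by noncomm_ring

theorem commutator_mul_right (a b c : A) :
    a * (b * c) - b * c * a = (a * b - b * a) * c + b * (a * c - c * a) := by noncomm_ring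

/-- The drop by one extends from letters to words because ad is a derivation in each argument: first
a letter against a word, then a word against a word, then bilinearity. -/
theorem commutator_mem_letterFil
    (hx : ∀ i j, x i * x j - x j * x i ∈ letterFil R x w (w i + w j - 1)) {d e f : ℤ} {a b : A}
    (ha : a ∈ letterFil R x w d) (hb : b ∈ letterFil R x w e) (h : d + e - 1 ≤ f) :
    a * b - b * a ∈ letterFil R x w f := by
  have h1 : ∀ (j : ι) (l : List ι),
      (l.map x).prod * x j - x j * (l.map x).prod ∈
        letterFil R x w ((l.map w).sum + w j - 1) := by
    intro j l
    induction l with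
    | nil => simp
    | cons i l ih =>
      simp only [List.map_cons, List.prod_cons, List.sum_cons]
      rw [commutator_mul_left]
      exact add_mem (mul_mem_letterFil (letter_mem_letterFil i le_rfl) ih (by omega))
        (mul_mem_letterFil (hx i j) (prod_mem_letterFil l le_rfl) (by omega))
  have h2 : ∀ (l l' : List ι), (l.map x).prod * (l'.map x).prod - (l'.map x).prod * (l.map x).prod ∈
        letterFil R x w ((l.map w).sum + (l'.map w).sum - 1) := by
    intro l l'
    induction l' with
    | nil => simp
    | cons i l' ih =>
      simp only [List.map_cons, List.prod_cons, List.sum_cons]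
      rw [commutator_mul_right]
      exact add_mem (mul_mem_letterFil (h1 i l) (prod_mem_letterFil l' le_rfl) (by omega))
        (mul_mem_letterFil (letter_mem_letterFil i le_rfl) ih (by omega))
  induction ha using Submodule.span_induction with
  | mem a ha =>
    obtain ⟨l, hl, rfl⟩ := ha
    induction hb using Submodule.span_induction with
    | mem b hb =>
      obtain ⟨l', hl', rfl⟩ := hb
      exact letterFil_mono (by omega) (h2 l l')
    | zero => simp
    | add p q _ _ hp hq =>
      rw [mul_add, add_mul, add_sub_add_comm]; exact add_mem hp hq
    | smul c p _ hp =>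
      rw [mul_smul_comm, smul_mul_assoc, ← smul_sub]; exact Submodule.smul_mem _ _ hp
  | zero => simp
  | add p q _ _ hp hq => rw [mul_add, add_mul, add_sub_add_comm]; exact add_mem hp hq
  | smul c p _ hp =>
    rw [mul_smul_comm, smul_mul_assoc, ← smul_sub]; exact Submodule.smul_mem _ _ hp

theorem prod_sub_prod_mem_letterFil_of_perm
    (hx : ∀ i j, x i * x j - x j * x i ∈ letterFil R x w (w i + w j - 1)) {l l' : List ι}
    (h : l.Perm l') :
    (l.map x).prod - (l'.map x).prod ∈ letterFil R x w ((l.map w).sum - 1) := by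
  induction h with
  | nil => simp
  | cons i _ ih =>
    simp only [List.map_cons, List.prod_cons, List.sum_cons, ← mul_sub]
    exact mul_mem_letterFil (letter_mem_letterFil i le_rfl) ih (by omega)
  | swap i j l =>
    simp only [List.map_cons, List.prod_cons, List.sum_cons, ← mul_assoc, ← sub_mul]
    exact mul_mem_letterFil (hx j i) (prod_mem_letterFil l le_rfl) (by omega)
  | trans h1 _ ih1 ih2 =>
    rw [← (h1.map w).sum_eq] at ih2
    simpa using add_mem ih1 ih2

/-- If all weights are nonnegative and every word can be rearranged to lie in `S`, then the
filtration is contained in `S`. -/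
theorem letterFil_le_of_rearrange
    (hx : ∀ i j, x i * x j - x j * x i ∈ letterFil R x w (w i + w j - 1)) (hw : ∀ i, 0 ≤ w i)
    (S : ℤ → Submodule R A) (hS : Monotone S)
    (hl : ∀ l : List ι, ∃ l' : List ι, l.Perm l' ∧ (l'.map x).prod ∈ S (l'.map w).sum) (d : ℤ) :
    letterFil R x w d ≤ S d := by
  -- Induction on a natural bound for `d`. For negative `d` there are no words at all, as weights
  -- are nonnegative; otherwise rearranging a word costs only an element of weight one less.
  have key : ∀ (k : ℕ) (d : ℤ), d < k → letterFil R x w d ≤ S d := by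
    intro k
    induction k with
    | zero =>
      intro d hd
      refine Submodule.span_le.2 ?_
      rintro _ ⟨l, hl, rfl⟩
      have : 0 ≤ (l.map w).sum := List.sum_nonneg (by simpa using fun i _ => hw i)
      push_cast at hd
      omega
    | succ k ih =>
      intro d hd
      refine Submodule.span_le.2 ?_
      rintro _ ⟨l, hd', rfl⟩
      obtain ⟨l', hp, hl'⟩ := hl l
      have h1 := prod_sub_prod_mem_letterFil_of_perm hx hp
      rw [← (hp.map w).sum_eq] at hl'
      have h2 := hS (show (l.map w).sum - 1 ≤ (l.map w).sum by omega)
        (ih _ (by push_cast at hd; omega) h1)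
      have h3 := add_mem h2 hl'
      rw [sub_add_cancel] at h3
      exact hS hd' h3
  exact key (d.toNat + 1) d (by omega)

end LetterFiltration

end WittLoc

namespace WittLoc

/-! ### Poincaré–Birkhoff–Witt independence through the comultiplication -/

section PBW

open TensorProduct

attribute [local instance] LieRing.ofAssociativeRing

variable (K L : Type*) [Field K] [LieRing L] [LieAlgebra K L]

/-- The comultiplication of the enveloping algebra, determined by `x ↦ x ⊗ 1 + 1 ⊗ x`. -/
noncomputable def envComul :
    UniversalEnvelopingAlgebra K L →ₐ[K]
      UniversalEnvelopingAlgebra K L ⊗[K] UniversalEnvelopingAlgebra K L :=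
  UniversalEnvelopingAlgebra.lift K
    { toFun := fun x => UniversalEnvelopingAlgebra.ι K x ⊗ₜ 1 + 1 ⊗ₜ UniversalEnvelopingAlgebra.ι K x
      map_add' := fun x y => by
        simp only [map_add, TensorProduct.add_tmul, TensorProduct.tmul_add]; abel
      map_smul' := fun c x => by
        simp only [map_smul, TensorProduct.smul_tmul', TensorProduct.tmul_smul, smul_add,
          RingHom.id_apply]
      map_lie' := fun {x y} => by
        simp only [LieHom.map_lie, LieRing.of_associative_ring_bracket, add_mul, mul_add,
          Algebra.TensorProduct.tmul_mul_tmul, one_mul, mul_one, TensorProduct.sub_tmul,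
          TensorProduct.tmul_sub]
        abel }

variable {K L}

theorem envComul_ι (x : L) :
    envComul K L (UniversalEnvelopingAlgebra.ι K x) =
      UniversalEnvelopingAlgebra.ι K x ⊗ₜ 1 + 1 ⊗ₜ UniversalEnvelopingAlgebra.ι K x :=
  UniversalEnvelopingAlgebra.lift_ι_apply K _ x

/-- All ways to take one entry out of a list, with the remaining list. -/
def listRemovals {ι : Type*} : List ι → List (ι × List ι)
  | [] => []
  | a :: l => (a, l) :: (listRemovals l).map fun p => (p.1, a :: p.2)

theorem perm_of_mem_listRemovals {ι : Type*} {l : List ι} {p : ι × List ι}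
    (h : p ∈ listRemovals l) : l.Perm (p.1 :: p.2) := by
  induction l generalizing p with
  | nil => simp [listRemovals] at h
  | cons a l ih =>
    simp only [listRemovals, List.mem_cons, List.mem_map] at h
    rcases h with rfl | ⟨q, hq, rfl⟩
    · exact List.Perm.refl _
    · exact ((ih hq).cons a).trans (List.Perm.swap _ _ _)

theorem map_fst_listRemovals {ι : Type*} (l : List ι) : (listRemovals l).map Prod.fst = l := by
  induction l with
  | nil => rfl
  | cons a l ih => simpa [listRemovals, Function.comp_def] using ih

variable {ι : Type*} (x : ι → L)

/-- The word in the enveloping algebra attached to a list of letters. -/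
noncomputable def envWord (l : List ι) : UniversalEnvelopingAlgebra K L :=
  (l.map fun i => UniversalEnvelopingAlgebra.ι K (x i)).prod

theorem envWord_cons (a : ι) (l : List ι) :
    envWord (K := K) x (a :: l) = UniversalEnvelopingAlgebra.ι K (x a) * envWord x l := by
  simp [envWord]

/-- Tensors whose second factor is a word shorter than `k` by at least two. -/
noncomputable def comulRemainder (K : Type*) {L ι : Type*} [Field K] [LieRing L] [LieAlgebra K L]
    (x : ι → L) (k : ℕ) :
    Submodule K (UniversalEnvelopingAlgebra K L ⊗[K] UniversalEnvelopingAlgebra K L) :=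
  Submodule.span K {z | ∃ u, ∃ l : List ι, l.length + 2 ≤ k ∧ u ⊗ₜ envWord x l = z}

theorem comul_letter_mul_mem {k : ℕ} (a : ι)
    {z : UniversalEnvelopingAlgebra K L ⊗[K] UniversalEnvelopingAlgebra K L}
    (hz : z ∈ comulRemainder K x k) :
    (UniversalEnvelopingAlgebra.ι K (x a) ⊗ₜ 1 + 1 ⊗ₜ UniversalEnvelopingAlgebra.ι K (x a)) * z ∈
      comulRemainder K x (k + 1) := by
  induction hz using Submodule.span_induction with
  | mem z hz =>
    obtain ⟨u, l, hl, rfl⟩ := hz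
    rw [add_mul, Algebra.TensorProduct.tmul_mul_tmul, Algebra.TensorProduct.tmul_mul_tmul, one_mul,
      one_mul, ← envWord_cons]
    exact add_mem (Submodule.subset_span ⟨_, l, by omega, rfl⟩)
      (Submodule.subset_span ⟨_, a :: l, by simp only [List.length_cons]; omega, rfl⟩)
  | zero => simp
  | add p q _ _ hp hq => rw [mul_add]; exact add_mem hp hq
  | smul c p _ hp => rw [mul_smul_comm]; exact Submodule.smul_mem _ _ hp

/-- Expanding ∏ (x ⊗ 1 + 1 ⊗ x) sorts the terms by how many letters go to the left factor: none,
exactly one, or at least two. The last kind forms the remainder. -/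
theorem envComul_word_sub_mem (l : List ι) :
    envComul K L (envWord x l) - 1 ⊗ₜ envWord x l -
      ((listRemovals l).map fun p =>
        UniversalEnvelopingAlgebra.ι K (x p.1) ⊗ₜ[K] envWord (K := K) x p.2).sum ∈
      comulRemainder K x l.length := by
  induction l with
  | nil => simp [envWord, listRemovals, Algebra.TensorProduct.one_def]
  | cons a l ih =>
    have h1 := comul_letter_mul_mem x a ih
    have h2 : ((listRemovals l).map fun p =>
        (UniversalEnvelopingAlgebra.ι K (x a) * UniversalEnvelopingAlgebra.ι K (x p.1)) ⊗ₜ[K]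
          envWord (K := K) x p.2).sum ∈ comulRemainder K x (l.length + 1) := by
      refine list_sum_mem fun z hz => ?_
      obtain ⟨p, hp, rfl⟩ := List.mem_map.1 hz
      have := (perm_of_mem_listRemovals hp).length_eq
      simp only [List.length_cons] at this
      exact Submodule.subset_span ⟨_, p.2, by omega, rfl⟩
    have h3 := add_mem h1 h2
    rw [List.length_cons]
    convert h3 using 1
    simp only [envWord_cons, map_mul, envComul_ι, mul_sub, add_mul, listRemovals, List.map_cons,
      List.sum_cons, List.map_map, Function.comp_def, Algebra.TensorProduct.tmul_mul_tmul, one_mul,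
      mul_one, ← List.sum_map_mul_left,
      List.sum_map_add]
    abel

variable (ψ : ι → UniversalEnvelopingAlgebra K L →ₗ[K] K)

/-- The convolution product of functionals `ψ i` on the enveloping algebra over a list of
letters. -/
noncomputable def convCoeff : List ι → UniversalEnvelopingAlgebra K L →ₗ[K] K
  | [] => (UniversalEnvelopingAlgebra.lift K (0 : L →ₗ⁅K⁆ K)).toLinearMap
  | i :: I => LinearMap.mul' K K ∘ₗ TensorProduct.map (ψ i) (convCoeff I) ∘ₗ
      (envComul K L).toLinearMap

/-- Of the three kinds of terms in the comultiplication, the first dies because ψ_i(1) = 0, and the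
remainder because its right factors are shorter than `I`. Only the removals of a single letter
survive, and ψ_i selects the letter `i`. -/
theorem convCoeff_cons_word [DecidableEq ι] (h1 : ∀ i, ψ i 1 = 0)
    (h2 : ∀ i j, ψ i (UniversalEnvelopingAlgebra.ι K (x j)) = if i = j then 1 else 0)
    (i : ι) (I l : List ι) (hl : l.length ≤ I.length + 1)
    (hI : ∀ l' : List ι, l'.length < I.length → convCoeff ψ I (envWord x l') = 0) :
    convCoeff ψ (i :: I) (envWord x l) =
      ((listRemovals l).map fun p => if i = p.1 then convCoeff ψ I (envWord x p.2) else 0).sum := by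
  have h3 : ∀ z ∈ comulRemainder K x l.length,
      LinearMap.mul' K K (TensorProduct.map (ψ i) (convCoeff ψ I) z) = 0 := by
    intro z hz
    induction hz using Submodule.span_induction with
    | mem z hz =>
      obtain ⟨u, l', hl', rfl⟩ := hz
      simp [hI l' (by omega)]
    | zero => simp
    | add p q _ _ hp hq => rw [map_add, map_add, hp, hq, add_zero]
    | smul c p _ hp => rw [map_smul, map_smul, hp, smul_zero]
  have h4 := h3 _ (envComul_word_sub_mem x l)
  rw [map_sub, map_sub, map_sub, map_sub, sub_sub, sub_eq_zero] at h4
  change LinearMap.mul' K K (TensorProduct.map (ψ i) (convCoeff ψ I)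
    (envComul K L (envWord x l))) = _
  rw [h4]
  simp only [TensorProduct.map_tmul, LinearMap.mul'_apply, h1, zero_mul, zero_add, map_list_sum,
    List.map_map, Function.comp_def, h2, ite_mul, one_mul]

theorem convCoeff_word_of_lt (h1 : ∀ i, ψ i 1 = 0) [DecidableEq ι]
    (h2 : ∀ i j, ψ i (UniversalEnvelopingAlgebra.ι K (x j)) = if i = j then 1 else 0)
    (I l : List ι) (hl : l.length < I.length) : convCoeff ψ I (envWord x l) = 0 := by
  induction I generalizing l with
  | nil => simp at hl
  | cons i I ih =>
    rw [List.length_cons] at hl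
    rw [convCoeff_cons_word x ψ h1 h2 i I l hl.le ih]
    refine List.sum_eq_zero fun z hz => ?_
    obtain ⟨p, hp, rfl⟩ := List.mem_map.1 hz
    have := (perm_of_mem_listRemovals hp).length_eq
    simp only [List.length_cons] at this
    rw [ih p.2 (by omega), ite_self]

theorem convCoeff_word_of_not_perm (h1 : ∀ i, ψ i 1 = 0) [DecidableEq ι]
    (h2 : ∀ i j, ψ i (UniversalEnvelopingAlgebra.ι K (x j)) = if i = j then 1 else 0)
    (I l : List ι) (hl : l.length = I.length) (hp : ¬ l.Perm I) :
    convCoeff ψ I (envWord x l) = 0 := by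
  induction I generalizing l with
  | nil => exact absurd (List.length_eq_zero_iff.1 hl ▸ List.Perm.refl _) hp
  | cons i I ih =>
    rw [List.length_cons] at hl
    rw [convCoeff_cons_word x ψ h1 h2 i I l hl.le (convCoeff_word_of_lt x ψ h1 h2 I)]
    refine List.sum_eq_zero fun z hz => ?_
    obtain ⟨p, hp', rfl⟩ := List.mem_map.1 hz
    have h3 := perm_of_mem_listRemovals hp'
    have := h3.length_eq
    simp only [List.length_cons] at this
    split_ifs with h
    · exact ih p.2 (by omega) fun h4 => hp (h3.trans (h ▸ h4.cons _))
    · rfl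

/-- The value is the product of the factorials of the multiplicities in `I`, which is nonzero in
characteristic zero. -/
theorem exists_convCoeff_word_of_perm [CharZero K] (h1 : ∀ i, ψ i 1 = 0) [DecidableEq ι]
    (h2 : ∀ i j, ψ i (UniversalEnvelopingAlgebra.ι K (x j)) = if i = j then 1 else 0)
    (I : List ι) :
    ∃ N : K, N ≠ 0 ∧ ∀ l : List ι, l.Perm I → convCoeff ψ I (envWord x l) = N := by
  induction I with
  | nil =>
    refine ⟨1, one_ne_zero, fun l hl => ?_⟩
    rw [List.perm_nil.1 hl]
    simp [convCoeff, envWord]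
  | cons i I ih =>
    obtain ⟨N, hN, hI⟩ := ih
    -- Each occurrence of `i` in `l` can be the removed letter and leaves a rearrangement of `I`,
    -- contributing `N`.
    refine ⟨((i :: I).count i : ℕ) * N, mul_ne_zero (Nat.cast_ne_zero.2 (by simp)) hN, fun l hl => ?_⟩
    rw [convCoeff_cons_word x ψ h1 h2 i I l hl.length_eq.le (convCoeff_word_of_lt x ψ h1 h2 I)]
    have h3 : ((listRemovals l).map fun p =>
        if i = p.1 then convCoeff ψ I (envWord x p.2) else 0) =
        ((listRemovals l).map Prod.fst).map fun j => if i = j then N else 0 := by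
      rw [List.map_map]
      refine List.map_congr_left fun p hp => ?_
      simp only [Function.comp_apply]
      split_ifs with h
      · refine hI _ (List.Perm.cons_inv (a := i) ?_)
        exact (h ▸ (perm_of_mem_listRemovals hp).symm).trans hl
      · rfl
    rw [h3, map_fst_listRemovals, ← hl.count_eq]
    clear h3 hl
    induction l with
    | nil => simp
    | cons j l ih =>
      rw [List.map_cons, List.sum_cons, ih, List.count_cons]
      by_cases h : i = j
      · subst h; simp; ring
      · simp [h, Ne.symm h]

/-- Independence in the Poincaré–Birkhoff–Witt theorem: words that are not rearrangements of
each other are linearly independent, provided that there are functionals on the enveloping algebra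
that vanish at `1` and are dual to the letters. -/
theorem linearIndependent_envWord [CharZero K] (h1 : ∀ i, ψ i 1 = 0) [DecidableEq ι]
    (h2 : ∀ i j, ψ i (UniversalEnvelopingAlgebra.ι K (x j)) = if i = j then 1 else 0)
    {σ : Type*} (l : σ → List ι) (hl : ∀ s s', (l s).Perm (l s') → s = s') :
    LinearIndependent K fun s => envWord (K := K) x (l s) := by
  classical
  rw [linearIndependent_iff']
  intro t g hg s hs
  by_contra hne
  -- For a longest word with nonzero coefficient, the convolution functional of that word kills all
  -- other words of the relation.
  obtain ⟨m, hm, hmax⟩ := (t.filter fun s => g s ≠ 0).exists_max_image (fun s => (l s).length)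
    ⟨s, by simp [hs, hne]⟩
  obtain ⟨N, hN, hval⟩ := exists_convCoeff_word_of_perm x ψ h1 h2 (l m)
  have h3 := congrArg (convCoeff ψ (l m)) hg
  rw [Finset.mem_filter] at hm
  rw [map_sum, map_zero, Finset.sum_eq_single m] at h3
  · rw [map_smul, hval _ (List.Perm.refl _), smul_eq_mul] at h3
    exact mul_ne_zero hm.2 hN h3
  · intro s' hs' hne'
    by_cases h0 : g s' = 0
    · simp [h0]
    rw [map_smul]
    rcases (hmax s' (by simp [hs', h0])).lt_or_eq with h | h
    · rw [convCoeff_word_of_lt x ψ h1 h2 _ _ h, smul_zero]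
    · rw [convCoeff_word_of_not_perm x ψ h1 h2 _ _ h fun hp => hne' (hl _ _ hp), smul_zero]
  · exact fun h => absurd hm.1 h

end PBW

end WittLoc

namespace WittLoc

/-! ### Products of commuting families -/

section CommutingProducts

theorem prod_ofFn_mul_of_commute {M : Type*} [Monoid M] {n : ℕ} (f g : Fin n → M)
    (h : ∀ i j, Commute (g i) (f j)) :
    (List.ofFn fun i => f i * g i).prod = (List.ofFn f).prod * (List.ofFn g).prod := by
  induction n with
  | zero => simp
  | succ n ih =>
    simp only [List.ofFn_succ, List.prod_cons]
    rw [ih (fun i => f i.succ) (fun i => g i.succ) fun i j => h _ _]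
    have h1 : Commute (g 0) (List.ofFn fun i => f (Fin.succ i)).prod :=
      Commute.list_prod_right _ _ fun y hy => by
        obtain ⟨i, rfl⟩ := List.mem_ofFn.1 hy
        exact h _ _
    rw [mul_assoc, ← mul_assoc (g 0), h1.eq]
    simp only [mul_assoc]

theorem prod_ofFn_eq_of_forall_ne {M : Type*} [Monoid M] {n : ℕ} (f : Fin n → M) (i : Fin n)
    (h : ∀ j, j ≠ i → f j = 1) : (List.ofFn f).prod = f i := by
  induction n with
  | zero => exact i.elim0
  | succ n ih =>
    rw [List.ofFn_succ, List.prod_cons]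
    rcases Fin.eq_zero_or_eq_succ i with rfl | ⟨k, rfl⟩
    · rw [List.prod_eq_one, mul_one]
      intro y hy
      obtain ⟨j, rfl⟩ := List.mem_ofFn.1 hy
      exact h _ (Fin.succ_ne_zero j)
    · rw [h 0 (Fin.succ_ne_zero k).symm, one_mul]
      exact ih (fun j => f j.succ) k fun j hj => h _ fun e => hj (Fin.succ_injective _ e)

variable {A : Type*} [Ring A] [Algebra ℂ A] {n : ℕ}

/-- Evaluation of polynomials at commuting elements of a noncommutative algebra. -/
noncomputable def commEval (y : Fin n → A) (hy : ∀ i j, Commute (y i) (y j)) :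
    MvPolynomial (Fin n) ℂ →ₐ[ℂ] A :=
  AddMonoidAlgebra.lift ℂ A (Fin n →₀ ℕ)
    { toFun := fun s => (List.ofFn fun i => y i ^ (Multiplicative.toAdd s) i).prod
      map_one' := by simp
      map_mul' := fun s t => by
        simp only [toAdd_mul, Finsupp.add_apply, pow_add]
        exact prod_ofFn_mul_of_commute _ _ fun i j => (hy i j).pow_pow _ _ }

theorem commEval_monomial (y : Fin n → A) (hy : ∀ i j, Commute (y i) (y j)) (s : Fin n →₀ ℕ)
    (c : ℂ) :
    commEval y hy (MvPolynomial.monomial s c) = c • (List.ofFn fun i => y i ^ s i).prod :=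
  AddMonoidAlgebra.lift_single _ _ _

theorem commEval_X (y : Fin n → A) (hy : ∀ i j, Commute (y i) (y j)) (i : Fin n) :
    commEval y hy (MvPolynomial.X i) = y i := by
  rw [MvPolynomial.X, commEval_monomial, one_smul, prod_ofFn_eq_of_forall_ne _ i, Finsupp.single_eq_same,
    pow_one]
  intro j hj
  rw [Finsupp.single_eq_of_ne hj, pow_zero]

theorem commEval_eq_sum (y : Fin n → A) (hy : ∀ i j, Commute (y i) (y j))
    (g : MvPolynomial (Fin n) ℂ) :
    commEval y hy g = ∑ s ∈ g.support, g.coeff s • (List.ofFn fun i => y i ^ s i).prod := by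
  conv_lhs => rw [g.as_sum]
  simp only [map_sum, commEval_monomial]

/-- If `d` acts on the commuting elements `y j` as `∂/∂y_i`, it acts on all polynomials in them as
the partial derivative. -/
theorem commutator_commEval (y : Fin n → A) (hy : ∀ i j, Commute (y i) (y j)) (i : Fin n) (d : A)
    (hd : ∀ j, d * y j = y j * d + if i = j then 1 else 0) (g : MvPolynomial (Fin n) ℂ) :
    d * commEval y hy g = commEval y hy g * d + commEval y hy (MvPolynomial.pderiv i g) := by
  induction g using MvPolynomial.induction_on with
  | C c =>
    rw [MvPolynomial.pderiv_C, map_zero, add_zero, MvPolynomial.C_eq_smul_one, map_smul, map_one,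
      mul_smul_comm, smul_mul_assoc, one_mul, mul_one]
  | add p q hp hq => simp only [map_add, mul_add, add_mul, hp, hq]; abel
  | mul_X p j hp =>
    rw [map_mul, commEval_X, ← mul_assoc, hp, add_mul, mul_assoc, hd, MvPolynomial.pderiv_mul,
      map_add, map_mul, map_mul, commEval_X, MvPolynomial.pderiv_X, mul_add, ← mul_assoc, add_assoc,
      add_comm (commEval y hy p * ite _ _ _)]
    congr 3
    rcases eq_or_ne i j with rfl | h
    · simp
    · simp [h]

end CommutingProducts

/-! ### Eigenvectors of inner derivations -/

section Eigen

variable {A : Type*} [Ring A] [Algebra ℂ A]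

/-- `u` is an eigenvector of `ad h` with eigenvalue `c`. -/
def IsAdEigen (h u : A) (c : ℂ) : Prop := h * u - u * h = c • u

theorem IsAdEigen.mul {h u v : A} {c d : ℂ} (hu : IsAdEigen h u c) (hv : IsAdEigen h v d) :
    IsAdEigen h (u * v) (c + d) := by
  unfold IsAdEigen at *
  rw [commutator_mul_right, hu, hv, smul_mul_assoc, mul_smul_comm, add_smul]

theorem IsAdEigen.of_commute {h u : A} (hu : Commute h u) : IsAdEigen h u 0 := by
  rw [IsAdEigen, hu.eq, sub_self, zero_smul]

theorem IsAdEigen.pow {h u : A} {c : ℂ} (hu : IsAdEigen h u c) (k : ℕ) :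
    IsAdEigen h (u ^ k) (k * c) := by
  induction k with
  | zero => simpa using IsAdEigen.of_commute (Commute.one_right h)
  | succ k ih =>
    rw [pow_succ]
    convert ih.mul hu using 1
    push_cast; ring

theorem IsAdEigen.inv {h : A} {u : Aˣ} {c : ℂ} (hu : IsAdEigen h u c) :
    IsAdEigen h (u⁻¹ : Aˣ) (-c) := by
  unfold IsAdEigen at *
  have h1 : (u⁻¹ : Aˣ) * (h * u - u * h) * (u⁻¹ : Aˣ) = (u⁻¹ : Aˣ) * (c • (u : A)) * (u⁻¹ : Aˣ) := by
    rw [hu]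
  simp only [mul_sub, sub_mul, mul_assoc, Units.mul_inv, mul_one, Units.inv_mul_cancel_left,
    smul_mul_assoc, mul_smul_comm] at h1
  rw [neg_smul, ← h1, neg_sub]

theorem IsAdEigen.zpow {h : A} {u : Aˣ} {c : ℂ} (hu : IsAdEigen h u c) (k : ℤ) :
    IsAdEigen h (u ^ k : Aˣ) (k * c) := by
  cases k with
  | ofNat k => simpa using hu.pow k
  | negSucc k =>
    have := (hu.pow (k + 1))
    rw [← Units.val_pow_eq_pow_val] at this
    rw [zpow_negSucc]
    convert this.inv using 1
    push_cast; ring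

theorem IsAdEigen.prod_ofFn {h : A} {n : ℕ} {f : Fin n → A} {c : Fin n → ℂ}
    (hf : ∀ i, IsAdEigen h (f i) (c i)) : IsAdEigen h (List.ofFn f).prod (∑ i, c i) := by
  induction n with
  | zero => simpa using IsAdEigen.of_commute (Commute.one_right h)
  | succ n ih =>
    rw [List.ofFn_succ, List.prod_cons, Fin.sum_univ_succ]
    exact (hf 0).mul (ih fun i => hf i.succ)

end Eigen

/-! ### The Witt algebra and its image in the localization -/

variable {n : ℕ}

theorem vf_apply_X (m : Fin n →₀ ℕ) (i k : Fin n) :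
    vf m i (MvPolynomial.X k) = if i = k then MvPolynomial.monomial m (1 : ℂ) else 0 := by
  rw [vf, Derivation.smul_apply, MvPolynomial.pderiv_X, smul_eq_mul]
  rcases eq_or_ne i k with rfl | h
  · simp
  · simp [h]

theorem pderiv_eq_vf (i : Fin n) : (MvPolynomial.pderiv i : W n) = vf 0 i := by
  rw [vf, MvPolynomial.monomial_zero', map_one, one_smul]

theorem vf_apply_monomial (m s : Fin n →₀ ℕ) (i : Fin n) :
    vf m i (MvPolynomial.monomial s (1 : ℂ)) =
      (s i : ℂ) • MvPolynomial.monomial (m + s - Finsupp.single i 1) 1 := by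
  rw [vf, Derivation.smul_apply, MvPolynomial.pderiv_monomial, smul_eq_mul,
    MvPolynomial.monomial_mul, MvPolynomial.smul_monomial, one_mul, one_mul, smul_eq_mul, mul_one]
  rcases Nat.eq_zero_or_pos (s i) with h | h
  · simp [h]
  · rw [add_tsub_assoc_of_le]
    rwa [Finsupp.single_le_iff]

theorem bracket_vf (m s : Fin n →₀ ℕ) (i j : Fin n) :
    ⁅(vf m i : W n), vf s j⁆ = (s i : ℂ) • vf (m + s - Finsupp.single i 1) j -
      (m j : ℂ) • vf (m + s - Finsupp.single j 1) i := by
  refine MvPolynomial.derivation_ext fun k => ?_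
  rw [Derivation.commutator_apply, Derivation.sub_apply, Derivation.smul_apply,
    Derivation.smul_apply, vf_apply_X, vf_apply_X, vf_apply_X, vf_apply_X]
  have h1 : vf m i (if j = k then MvPolynomial.monomial s (1 : ℂ) else 0) =
      if j = k then (s i : ℂ) • MvPolynomial.monomial (m + s - Finsupp.single i 1) 1 else 0 := by
    split_ifs
    · exact vf_apply_monomial _ _ _
    · exact map_zero _
  have h2 : vf s j (if i = k then MvPolynomial.monomial m (1 : ℂ) else 0) =
      if i = k then (m j : ℂ) • MvPolynomial.monomial (m + s - Finsupp.single j 1) 1 else 0 := by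
    split_ifs
    · rw [vf_apply_monomial, add_comm s m]
    · exact map_zero _
  rw [h1, h2, smul_ite, smul_ite, smul_zero, smul_zero]

theorem span_vf : Submodule.span ℂ (Set.range fun p : (Fin n →₀ ℕ) × Fin n => (vf p.1 p.2 : W n)) = ⊤ := by
  rw [eq_top_iff]
  intro D _
  have h1 : D = ∑ i, D (MvPolynomial.X i) • (MvPolynomial.pderiv i : W n) := by
    refine MvPolynomial.derivation_ext fun k => ?_
    rw [← Derivation.coeFnAddMonoidHom_apply, ← Derivation.coeFnAddMonoidHom_apply, map_sum,
      Finset.sum_apply, Finset.sum_eq_single k]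
    · simp
    · intro i _ hi
      simp [hi.symm]
    · simp
  rw [h1]
  refine Submodule.sum_mem _ fun i _ => ?_
  rw [(D (MvPolynomial.X i)).as_sum, Finset.sum_smul]
  refine Submodule.sum_mem _ fun s _ => ?_
  have h2 : MvPolynomial.monomial s ((D (MvPolynomial.X i)).coeff s) • (MvPolynomial.pderiv i : W n) =
      (D (MvPolynomial.X i)).coeff s • vf s i := by
    rw [vf, ← smul_assoc, MvPolynomial.smul_monomial, smul_eq_mul, mul_one]
  rw [h2]
  exact Submodule.smul_mem _ _ (Submodule.subset_span ⟨(s, i), rfl⟩)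

variable (n) in
/-- The localization map as a homomorphism of algebras. -/
noncomputable def num : U n →ₐ[ℂ] Uloc n :=
  { (OreLocalization.numeratorRingHom : U n →+* Uloc n) with commutes' := fun _ => rfl }

theorem num_ι (x : W n) : num n (UniversalEnvelopingAlgebra.ι ℂ x) = toUloc x := rfl

variable (n) in
/-- `toUloc` as a linear map. -/
noncomputable def toUlocₗ : W n →ₗ[ℂ] Uloc n :=
  letI : LieRing (U n) := LieRing.ofAssociativeRing
  (num n).toLinearMap ∘ₗ (UniversalEnvelopingAlgebra.ι ℂ : W n →ₗ⁅ℂ⁆ U n).toLinearMap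

theorem toUlocₗ_apply (x : W n) : toUlocₗ n x = toUloc x := rfl

theorem toUloc_bracket (x y : W n) :
    toUloc x * toUloc y - toUloc y * toUloc x = toUloc ⁅x, y⁆ := by
  let _ : LieRing (U n) := LieRing.ofAssociativeRing
  rw [← num_ι, ← num_ι, ← num_ι, LieHom.map_lie, LieRing.of_associative_ring_bracket, map_sub,
    map_mul, map_mul]

theorem toUloc_vf_commutator (m s : Fin n →₀ ℕ) (i j : Fin n) :
    toUloc (vf m i) * toUloc (vf s j) - toUloc (vf s j) * toUloc (vf m i) =
      (s i : ℂ) • toUloc (vf (m + s - Finsupp.single i 1) j) -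
        (m j : ℂ) • toUloc (vf (m + s - Finsupp.single j 1) i) := by
  rw [toUloc_bracket, bracket_vf, ← toUlocₗ_apply, map_sub, map_smul, map_smul]; rfl

theorem val_delUnit (i : Fin n) : (delUnit i : Uloc n) = toUloc (vf 0 i) := by
  rw [← pderiv_eq_vf]; rfl

theorem delUnit_mul_toUloc (s : Fin n →₀ ℕ) (i j : Fin n) :
    (delUnit i : Uloc n) * toUloc (vf s j) = toUloc (vf s j) * delUnit i +
      (s i : ℂ) • toUloc (vf (s - Finsupp.single i 1) j) := by
  have := toUloc_vf_commutator 0 s i j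
  rw [← val_delUnit, zero_add, Finsupp.coe_zero, Pi.zero_apply, Nat.cast_zero, zero_smul,
    sub_zero] at this
  rw [← this, add_sub_cancel]

theorem isAdEigen_toUloc (s : Fin n →₀ ℕ) (i j : Fin n) :
    IsAdEigen (hElt i) (toUloc (vf s j)) ((s i : ℂ) - if i = j then 1 else 0) := by
  rw [IsAdEigen, hElt, toUloc_vf_commutator, add_tsub_cancel_left, sub_smul]
  congr 1
  rcases eq_or_ne i j with rfl | h
  · simp
  · simp [h, Finsupp.single_eq_of_ne h.symm]

theorem commute_delUnit (i j : Fin n) : Commute (delUnit i) (delUnit j) := by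
  refine Units.ext ?_
  rw [Units.val_mul, Units.val_mul, val_delUnit j, delUnit_mul_toUloc]
  simp

theorem isAdEigen_delUnit (i j : Fin n) :
    IsAdEigen (hElt i) (delUnit j : Uloc n) (-if i = j then 1 else 0) := by
  simpa [val_delUnit] using isAdEigen_toUloc 0 i j

theorem commute_hElt (i j : Fin n) : Commute (hElt i : Uloc n) (hElt j) := by
  have := isAdEigen_toUloc (Finsupp.single j 1) i j
  rcases eq_or_ne i j with rfl | h
  · exact Commute.refl _
  · rw [IsAdEigen, Finsupp.single_eq_of_ne h] at this
    rw [if_neg h, Nat.cast_zero, sub_zero, zero_smul, sub_eq_zero] at this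
    exact this

theorem isAdEigen_delPow (i : Fin n) (a : Fin n → ℤ) :
    IsAdEigen (hElt i) (delPow a : Uloc n) (-a i) := by
  rw [delPow, ← Units.coeHom_apply, map_list_prod, List.map_ofFn]
  have h := IsAdEigen.prod_ofFn fun j => (isAdEigen_delUnit i j).zpow (a j)
  rw [show ∑ j, (a j : ℂ) * (-if i = j then 1 else 0) = -a i by simp] at h
  exact h

theorem delPow_add (a b : Fin n → ℤ) : (delPow (a + b) : Uloc n) = delPow a * delPow b := by
  rw [delPow, delPow, delPow, ← Units.val_mul, ← prod_ofFn_mul_of_commute]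
  · simp only [Pi.add_apply, zpow_add]
  · exact fun i j => (commute_delUnit i j).zpow_zpow _ _

theorem delPow_zero : (delPow 0 : Uloc n) = 1 := by
  simp [delPow]

theorem delPow_single (i : Fin n) (k : ℤ) :
    (delPow (Pi.single i k) : Uloc n) = (delUnit i ^ k : (Uloc n)ˣ) := by
  rw [delPow, prod_ofFn_eq_of_forall_ne _ i, Pi.single_eq_same]
  intro j hj
  rw [Pi.single_eq_of_ne hj, zpow_zero]

theorem commute_delPow (a b : Fin n → ℤ) : Commute (delPow a : Uloc n) (delPow b) := by
  rw [commute_iff_eq, ← delPow_add, ← delPow_add, add_comm]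

theorem delUnit_eq_delPow (i : Fin n) : (delUnit i : Uloc n) = delPow (Pi.single i 1) := by
  rw [delPow_single, zpow_one]

/-- The element `h_i ∂_i⁻¹`, which plays the role of `t_i`. -/
noncomputable def tElt (i : Fin n) : Uloc n := hElt i * (delUnit i ^ (-1 : ℤ) : (Uloc n)ˣ)

theorem tElt_eq (i : Fin n) : (tElt i : Uloc n) = hElt i * delPow (Pi.single i (-1)) := by
  rw [tElt, delPow_single]

theorem tElt_mul_delUnit (i : Fin n) : (tElt i : Uloc n) * delUnit i = hElt i := by
  simp [tElt, mul_assoc]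

/-- The Weyl relation: [∂_i, h_j] = δ_ij ∂_i, and multiplying by ∂_j⁻¹ turns the right side into
δ_ij. -/
theorem delUnit_mul_tElt (i j : Fin n) :
    (delUnit i : Uloc n) * tElt j = tElt j * delUnit i + if i = j then 1 else 0 := by
  have h1 := delUnit_mul_toUloc (Finsupp.single j 1) i j
  change (delUnit i : Uloc n) * hElt j = hElt j * delUnit i + _ at h1
  rw [tElt_eq, ← mul_assoc, h1, add_mul, mul_assoc, mul_assoc, delUnit_eq_delPow,
    (commute_delPow _ _).eq]
  congr 1
  rcases eq_or_ne i j with rfl | h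
  · simp only [Finsupp.single_eq_same, Nat.cast_one, one_smul, tsub_self, ← val_delUnit, if_true]
    rw [delUnit_eq_delPow, ← delPow_add, ← Pi.single_add]
    simp [delPow_zero]
  · simp [h, Finsupp.single_eq_of_ne h]

theorem isAdEigen_tElt (i j : Fin n) :
    IsAdEigen (hElt i) (tElt j : Uloc n) (if i = j then 1 else 0) := by
  rw [tElt_eq]
  convert (IsAdEigen.of_commute (commute_hElt i j)).mul (isAdEigen_delPow i _) using 1
  rcases eq_or_ne i j with rfl | h
  · simp
  · simp [h]

theorem commute_tElt (i j : Fin n) : Commute (tElt i : Uloc n) (tElt j) := by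
  rcases eq_or_ne i j with rfl | h
  · exact Commute.refl _
  have h1 : Commute (hElt i : Uloc n) (tElt j) := by
    have := isAdEigen_tElt i j
    rw [IsAdEigen, if_neg h, zero_smul, sub_eq_zero] at this
    exact this
  have h2 : Commute (delUnit i : Uloc n) (tElt j) := by
    have := delUnit_mul_tElt i j
    rw [if_neg h, add_zero] at this
    exact this
  rw [tElt]
  refine h1.mul_left ?_
  rw [zpow_neg_one]
  exact h2.units_inv_left

theorem polyH_eq_commEval (g : MvPolynomial (Fin n) ℂ) :
    polyH g = commEval hElt commute_hElt g := (commEval_eq_sum _ _ _).symm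

end WittLoc

namespace WittLoc

/-! ### Existence of the generators -/

variable {n : ℕ}

/-- `T^q`, where `T_i = h_i ∂_i⁻¹`. -/
noncomputable def tPow (q : Fin n →₀ ℕ) : Uloc n :=
  commEval tElt commute_tElt (MvPolynomial.monomial q 1)

theorem tPow_eq (q : Fin n →₀ ℕ) : (tPow q : Uloc n) = (List.ofFn fun i => tElt i ^ q i).prod := by
  rw [tPow, commEval_monomial, one_smul]

theorem tPow_zero : (tPow 0 : Uloc n) = 1 := by
  simp [tPow_eq]

theorem tPow_add_single (q : Fin n →₀ ℕ) (i : Fin n) :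
    (tPow (q + Finsupp.single i 1) : Uloc n) = tPow q * tElt i := by
  rw [tPow, tPow, ← commEval_X tElt commute_tElt i, ← map_mul, MvPolynomial.X,
    MvPolynomial.monomial_mul, one_mul]

theorem delUnit_mul_tPow (q : Fin n →₀ ℕ) (i : Fin n) :
    (delUnit i : Uloc n) * tPow q =
      tPow q * (delUnit i : Uloc n) + (q i : ℂ) • tPow (q - Finsupp.single i 1) := by
  rw [tPow, commutator_commEval tElt commute_tElt i _ (delUnit_mul_tElt i),
    MvPolynomial.pderiv_monomial, one_mul, tPow, ← map_smul, MvPolynomial.smul_monomial,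
    smul_eq_mul, mul_one]

theorem isAdEigen_tPow (q : Fin n →₀ ℕ) (i : Fin n) :
    IsAdEigen (hElt i) (tPow q : Uloc n) (q i) := by
  rw [tPow_eq]
  have h := IsAdEigen.prod_ofFn fun j => (isAdEigen_tElt i j).pow (q j)
  rw [show ∑ j, (q j : ℂ) * (if i = j then 1 else 0) = q i by simp] at h
  exact h

/-- `T^q ∂^q` is a polynomial in the `h_i` of degree at most `|q|`. -/
theorem exists_polyH_eq_tPow_mul_delPow (q : Fin n →₀ ℕ) :
    ∃ g : MvPolynomial (Fin n) ℂ, g.totalDegree ≤ q.degree ∧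
      polyH g = tPow q * delPow fun k => (q k : ℤ) := by
  have key : ∀ (N : ℕ) (q : Fin n →₀ ℕ), q.degree = N → ∃ g : MvPolynomial (Fin n) ℂ,
      g.totalDegree ≤ N ∧ polyH g = tPow q * delPow fun k => (q k : ℤ) := by
    intro N
    induction N with
    | zero =>
      intro q hq
      rw [Finsupp.degree_eq_zero_iff] at hq
      subst hq
      refine ⟨1, by simp, ?_⟩
      rw [polyH_eq_commEval, map_one, tPow_zero, one_mul]
      exact delPow_zero.symm
    | succ N ih =>
      intro q hq
      obtain ⟨i, hi⟩ : ∃ i, q i ≠ 0 := by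
        by_contra! h
        rw [show q = 0 from Finsupp.ext h, map_zero] at hq
        omega
      obtain ⟨s, rfl⟩ : ∃ s, q = s + Finsupp.single i 1 :=
        ⟨q - Finsupp.single i 1, (tsub_add_cancel_of_le (Finsupp.single_le_iff.2
          (Nat.one_le_iff_ne_zero.2 hi))).symm⟩
      rw [map_add, Finsupp.degree_single] at hq
      obtain ⟨g, hg, hgs⟩ := ih s (by omega)
      -- T^(s+e_i) ∂^(s+e_i) = T^s h_i ∂^s, and moving h_i to the right past ∂^s costs -s_i ∂^s.
      refine ⟨g * MvPolynomial.X i - (s i : ℂ) • g, ?_, ?_⟩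
      · refine (MvPolynomial.totalDegree_sub _ _).trans (max_le ?_ ?_)
        · refine (MvPolynomial.totalDegree_mul _ _).trans ?_
          rw [MvPolynomial.totalDegree_X]
          omega
        · exact (MvPolynomial.totalDegree_smul_le _ _).trans (by omega)
      · have h1 : (fun k => ((s + Finsupp.single i 1 : Fin n →₀ ℕ) k : ℤ)) =
            Pi.single i 1 + fun k => (s k : ℤ) := by
          funext k
          rcases eq_or_ne k i with rfl | h
          · simp [add_comm]
          · simp [h, Finsupp.single_eq_of_ne h]
        rw [polyH_eq_commEval, map_sub, map_mul, commEval_X, map_smul, ← polyH_eq_commEval, hgs,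
          h1, delPow_add, ← delUnit_eq_delPow, tPow_add_single, mul_assoc (tPow s) (tElt i),
          ← mul_assoc (tElt i), tElt_mul_delUnit]
        have h2 := isAdEigen_delPow (n := n) i fun k => (s k : ℤ)
        rw [IsAdEigen, sub_eq_iff_eq_add] at h2
        rw [h2, mul_add, Int.cast_natCast, neg_smul, mul_neg, mul_smul_comm, mul_assoc]
        abel
  exact key _ q rfl

/-- `1 / m!`. -/
noncomputable def invFactorial (m : Fin n →₀ ℕ) : ℂ := ∏ i, ((m i).factorial : ℂ)⁻¹

theorem invFactorial_ne_zero (m : Fin n →₀ ℕ) : invFactorial m ≠ 0 :=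
  Finset.prod_ne_zero_iff.2 fun _ _ => inv_ne_zero (Nat.cast_ne_zero.2 (Nat.factorial_ne_zero _))

theorem invFactorial_zero : invFactorial (0 : Fin n →₀ ℕ) = 1 := by
  simp [invFactorial]

theorem invFactorial_add_single_mul (m : Fin n →₀ ℕ) (i : Fin n) :
    invFactorial (m + Finsupp.single i 1) * ((m + Finsupp.single i 1 : Fin n →₀ ℕ) i : ℕ) = invFactorial m := by
  unfold invFactorial
  rw [← Finset.mul_prod_erase _ _ (Finset.mem_univ i), ← Finset.mul_prod_erase Finset.univ
    (fun k => ((m k).factorial : ℂ)⁻¹) (Finset.mem_univ i)]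
  have h1 : ∏ k ∈ Finset.univ.erase i, (((m + Finsupp.single i 1 : Fin n →₀ ℕ) k).factorial : ℂ)⁻¹ =
      ∏ k ∈ Finset.univ.erase i, ((m k).factorial : ℂ)⁻¹ := by
    refine Finset.prod_congr rfl fun k hk => ?_
    rw [Finsupp.add_apply, Finsupp.single_eq_of_ne (Finset.ne_of_mem_erase hk), add_zero]
  rw [h1, mul_right_comm]
  congr 1
  rw [Finsupp.add_apply, Finsupp.single_eq_same, Nat.factorial_succ]
  have h2 : ((m i).factorial : ℂ) ≠ 0 := Nat.cast_ne_zero.2 (Nat.factorial_ne_zero _)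
  have h3 : ((m i : ℂ) + 1) ≠ 0 := Nat.cast_add_one_ne_zero _
  push_cast
  field_simp

theorem eq_tsub_add_single_of_le {m : Fin n →₀ ℕ} {i : Fin n} (h : Finsupp.single i 1 ≤ m) :
    m = m - Finsupp.single i 1 + Finsupp.single i 1 := (tsub_add_cancel_of_le h).symm

theorem apply_eq_zero_of_not_single_le {m : Fin n →₀ ℕ} {i : Fin n}
    (h : ¬ Finsupp.single i 1 ≤ m) : m i = 0 := by
  rw [Finsupp.single_le_iff] at h
  omega

/-- The generating series of the `t^r ∂_j / r!`. -/
noncomputable def vfSeries (j : Fin n) : MvPowerSeries (Fin n) (Uloc n) :=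
  fun r => invFactorial r • toUloc (vf r j)

/-- The generating series of the `(-T)^q / q!`. -/
noncomputable def tSeries (n : ℕ) : MvPowerSeries (Fin n) (Uloc n) :=
  fun q => ((-1) ^ q.degree * invFactorial q) • tPow q

theorem coeff_vfSeries (j : Fin n) (r : Fin n →₀ ℕ) :
    MvPowerSeries.coeff r (vfSeries j) = invFactorial r • toUloc (vf r j) := rfl

theorem coeff_tSeries (q : Fin n →₀ ℕ) :
    MvPowerSeries.coeff q (tSeries n) = ((-1) ^ q.degree * invFactorial q) • tPow q := rfl

/-- Since [∂_i, t^r∂_j] = r_i t^(r-e_i)∂_j, the factor 1/r! makes ad ∂_i the shift by the variable,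
as for an exponential. -/
theorem delUnit_mul_vfSeries (i j : Fin n) :
    MvPowerSeries.C (delUnit i : Uloc n) * vfSeries j =
      vfSeries j * MvPowerSeries.C (delUnit i : Uloc n) + MvPowerSeries.X i * vfSeries j := by
  ext r
  rw [map_add, MvPowerSeries.coeff_C_mul, MvPowerSeries.coeff_mul_C, MvPowerSeries.X,
    MvPowerSeries.coeff_monomial_mul, coeff_vfSeries, coeff_vfSeries, mul_smul_comm,
    delUnit_mul_toUloc, smul_add, smul_mul_assoc, smul_smul]
  congr 1
  split_ifs with h
  · rw [one_mul]
    conv_lhs => rw [eq_tsub_add_single_of_le h]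
    rw [invFactorial_add_single_mul, add_tsub_cancel_right]
  · rw [apply_eq_zero_of_not_single_le h, Nat.cast_zero, mul_zero, zero_smul]

theorem delUnit_mul_tSeries (i : Fin n) :
    MvPowerSeries.C (delUnit i : Uloc n) * tSeries n =
      tSeries n * MvPowerSeries.C (delUnit i : Uloc n) - MvPowerSeries.X i * tSeries n := by
  ext r
  rw [map_sub, MvPowerSeries.coeff_C_mul, MvPowerSeries.coeff_mul_C, MvPowerSeries.X,
    MvPowerSeries.coeff_monomial_mul, coeff_tSeries, coeff_tSeries, mul_smul_comm,
    delUnit_mul_tPow, smul_add, smul_mul_assoc, smul_smul, sub_eq_add_neg]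
  congr 1
  split_ifs with h
  · rw [one_mul]
    conv_lhs => rw [eq_tsub_add_single_of_le h]
    rw [mul_assoc, invFactorial_add_single_mul, add_tsub_cancel_right, map_add,
      Finsupp.degree_single, pow_succ, mul_neg_one, neg_mul, neg_smul]
  · rw [apply_eq_zero_of_not_single_le h, Nat.cast_zero, mul_zero, zero_smul, neg_zero]

/-- The shifts of the two series under ad ∂_i have opposite signs and cancel in the product, because
the formal variables are central. -/
theorem commute_delUnit_coeff (m : Fin n →₀ ℕ) (i j : Fin n) :
    Commute (delUnit i : Uloc n) (MvPowerSeries.coeff m (vfSeries j * tSeries n)) := by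
  have h : MvPowerSeries.C (delUnit i : Uloc n) * (vfSeries j * tSeries n) =
      vfSeries j * tSeries n * MvPowerSeries.C (delUnit i : Uloc n) := by
    rw [← mul_assoc, delUnit_mul_vfSeries, add_mul, mul_assoc (vfSeries j), delUnit_mul_tSeries,
      mul_sub, ← mul_assoc (vfSeries j) (MvPowerSeries.X i), ← MvPowerSeries.X_mul, mul_assoc,
      mul_assoc, sub_add_cancel]
  have h1 := congrArg (MvPowerSeries.coeff m) h
  rwa [MvPowerSeries.coeff_C_mul, MvPowerSeries.coeff_mul_C] at h1

theorem sum_range_finsuppAntidiag {M : Type*} [AddCommMonoid M] (N : ℕ)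
    (F : (Fin n →₀ ℕ) → M) (S : Finset (Fin n →₀ ℕ)) (hS : ∀ r ∈ S, r.degree < N)
    (hF : ∀ r, r.degree < N → r ∉ S → F r = 0) :
    ∑ d ∈ Finset.range N, ∑ r ∈ Finset.univ.finsuppAntidiag d, F r = ∑ r ∈ S, F r := by
  have hmem : ∀ (d : ℕ) (r : Fin n →₀ ℕ), r ∈ Finset.univ.finsuppAntidiag d ↔ r.degree = d := by
    intro d r
    rw [Finset.mem_finsuppAntidiag, Finsupp.degree_eq_sum]
    simp
  rw [← Finset.sum_biUnion]
  · refine (Finset.sum_subset ?_ ?_).symm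
    · intro r hr
      simp only [Finset.mem_biUnion, Finset.mem_range, hmem]
      exact ⟨_, hS r hr, rfl⟩
    · intro r hr hr'
      simp only [Finset.mem_biUnion, Finset.mem_range, hmem] at hr
      obtain ⟨d, hd, rfl⟩ := hr
      exact hF r hd hr'
  · intro d _ e _ hde
    refine Finset.disjoint_left.2 fun r hr hr' => hde ?_
    rw [hmem] at hr hr'
    omega

/-- Brings the convolution sum over r + q = m to the shape of `HasLeadingTerm`: the pair (m, 0) is
the leading term and every other pair has |r| < |m|. -/
theorem sum_antidiagonal_eq_add_sum {M : Type*} [AddCommMonoid M] (m : Fin n →₀ ℕ)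
    (f : (Fin n →₀ ℕ) → (Fin n →₀ ℕ) → M) :
    ∑ p ∈ Finset.HasAntidiagonal.antidiagonal m, f p.1 p.2 = f m 0 +
      ∑ d ∈ Finset.range m.degree, ∑ r ∈ Finset.univ.finsuppAntidiag d,
        if r ≤ m then f r (m - r) else 0 := by
  classical
  set S := (Finset.HasAntidiagonal.antidiagonal m).erase (m, 0) with hS
  have hmem : ∀ p ∈ S, p.1 + p.2 = m ∧ p.2 ≠ 0 := by
    intro p hp
    rw [hS, Finset.mem_erase, Finset.HasAntidiagonal.mem_antidiagonal] at hp
    refine ⟨hp.2, fun h => hp.1 (Prod.ext ?_ h)⟩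
    rw [← hp.2, h, add_zero]
  rw [sum_range_finsuppAntidiag _ _ (S.image Prod.fst), ← Finset.add_sum_erase _ _
    (show (m, 0) ∈ Finset.HasAntidiagonal.antidiagonal m by simp), Finset.sum_image]
  · refine congrArg _ (Finset.sum_congr rfl fun p hp => ?_)
    have hp' := (hmem p hp).1
    rw [if_pos (hp' ▸ le_self_add), show m - p.1 = p.2 by rw [← hp', add_tsub_cancel_left]]
  · intro p hp p' hp' h
    have h1 := (hmem p hp).1
    rw [← (hmem p' hp').1, h] at h1
    exact Prod.ext h (add_left_cancel h1)
  · intro r hr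
    obtain ⟨p, hp, rfl⟩ := Finset.mem_image.1 hr
    obtain ⟨h1, h2⟩ := hmem p hp
    rw [← h1, map_add]
    have : p.2.degree ≠ 0 := by rwa [Ne, Finsupp.degree_eq_zero_iff]
    omega
  · intro r hr hr'
    refine if_neg fun hle => hr' (Finset.mem_image.2 ⟨(r, m - r), ?_, rfl⟩)
    rw [hS, Finset.mem_erase, Finset.HasAntidiagonal.mem_antidiagonal]
    refine ⟨fun e => ?_, add_tsub_cancel_of_le hle⟩
    rw [Prod.mk.injEq] at e
    rw [e.1] at hr
    exact hr.false

theorem polyH_smul (c : ℂ) (g : MvPolynomial (Fin n) ℂ) :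
    (polyH (c • g) : Uloc n) = c • polyH g := by
  rw [polyH_eq_commEval, polyH_eq_commEval, map_smul]

theorem term_smul (r : Fin n →₀ ℕ) (j : Fin n) (c : ℂ) (g : MvPolynomial (Fin n) ℂ) :
    term r j (c • g) = c • term r j g := by
  rw [term, term, polyH_smul, mul_smul_comm, smul_mul_assoc]

theorem mem_H_iff {u : Uloc n} :
    u ∈ H n ↔ (∀ i : Fin n, Commute (delUnit i : Uloc n) u) ∧ ∀ i : Fin n, Commute (hElt i : Uloc n) u := by
  rw [H, Subalgebra.mem_centralizer_iff]
  constructor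
  · exact fun h => ⟨fun i => h _ (Or.inl ⟨i, rfl⟩), fun i => h _ (Or.inr ⟨i, rfl⟩)⟩
  · rintro ⟨h1, h2⟩ _ (⟨i, rfl⟩ | ⟨i, rfl⟩)
    · exact h1 i
    · exact h2 i

theorem exists_mem_H_hasLeadingTerm (m : Fin n →₀ ℕ) (j : Fin n) :
    ∃ x ∈ H n, HasLeadingTerm m j x := by
  classical
  choose G hG1 hG2 using exists_polyH_eq_tPow_mul_delPow (n := n)
  set a : Fin n → ℤ := fun k => (m k : ℤ) - (Finsupp.single j 1 k : ℕ) with ha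
  -- The coefficient m! (-1)^|q| / (r! q!), normalized so that the leading one, at (m, 0), is 1.
  set κ : (Fin n →₀ ℕ) → (Fin n →₀ ℕ) → ℂ := fun r q =>
    (invFactorial m)⁻¹ * (invFactorial r * ((-1) ^ q.degree * invFactorial q)) with hκ
  have hκm : κ m 0 = 1 := by
    simp only [hκ, map_zero, pow_zero, invFactorial_zero, mul_one]
    exact inv_mul_cancel₀ (invFactorial_ne_zero m)
  set x : Uloc n := ((invFactorial m)⁻¹ • MvPowerSeries.coeff m (vfSeries j * tSeries n)) *
    delPow a with hx
  have hx1 : x = ∑ p ∈ Finset.HasAntidiagonal.antidiagonal m, κ p.1 p.2 • (toUloc (vf p.1 j) * tPow p.2 * delPow a) := by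
    rw [hx, MvPowerSeries.coeff_mul, Finset.smul_sum, Finset.sum_mul]
    refine Finset.sum_congr rfl fun p _ => ?_
    rw [coeff_vfSeries, coeff_tSeries, smul_mul_smul_comm, smul_smul, smul_mul_assoc]
  have hx2 : x = ∑ p ∈ Finset.HasAntidiagonal.antidiagonal m, term p.1 j (κ p.1 p.2 • G p.2) := by
    rw [hx1]
    refine Finset.sum_congr rfl fun p hp => ?_
    -- As r + q = m, the power ∂^(m - e_j) splits into ∂^q, absorbed by T^q into a polynomial in the
    -- h_i, and ∂^(r - e_j).
    rw [term_smul, term, hG2, mul_assoc, mul_assoc, mul_assoc, ← delPow_add]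
    congr 4
    funext k
    simp only [ha, Pi.add_apply, Finsupp.add_apply, ← Finset.HasAntidiagonal.mem_antidiagonal.1 hp]
    push_cast
    ring
  refine ⟨x, mem_H_iff.2 ⟨fun i => ?_, fun i => ?_⟩, fun r =>
    if r ≤ m then κ r (m - r) • G (m - r) else 0, fun r hr => ?_, ?_⟩
  · exact ((commute_delUnit_coeff m i j).smul_right _).mul_right
      (delUnit_eq_delPow (n := n) i ▸ commute_delPow _ _)
  · rw [hx1]
    refine Commute.sum_right _ _ _ fun p hp => Commute.smul_right ?_ _
    have h := ((isAdEigen_toUloc p.1 i j).mul (isAdEigen_tPow p.2 i)).mul (isAdEigen_delPow i a)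
    -- The ad h_i eigenvalues of t^r∂_j, T^q and ∂^(m - e_j) add up to zero.
    have h0 : (p.1 i : ℂ) - (if i = j then 1 else 0) + (p.2 i : ℂ) + -(a i : ℂ) = 0 := by
      simp only [ha, ← Finset.HasAntidiagonal.mem_antidiagonal.1 hp, Finsupp.add_apply, Finsupp.single_apply]
      rcases eq_or_ne i j with rfl | h
      · simp only [if_true]; push_cast; ring
      · simp only [if_neg h, if_neg h.symm]; push_cast; ring
    rw [h0, IsAdEigen, zero_smul, sub_eq_zero] at h
    exact h
  · dsimp only
    split_ifs with h
    · refine (MvPolynomial.totalDegree_smul_le _ _).trans ((hG1 _).trans ?_)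
      have : (m - r).degree + r.degree = m.degree := by
        rw [← map_add, tsub_add_cancel_of_le h]
      omega
    · simp
  · rw [hx2, sum_antidiagonal_eq_add_sum m fun r q => term r j (κ r q • G q)]
    congr 1
    · rw [hκm, one_smul, term, hG2, tPow_zero, one_mul,
        show (fun k => ((0 : Fin n →₀ ℕ) k : ℤ)) = 0 from funext fun _ => by simp, delPow_zero,
        mul_one]
    · refine Finset.sum_congr rfl fun d _ => Finset.sum_congr rfl fun r _ => ?_
      dsimp only
      split_ifs with h
      · rfl
      · rw [term, polyH_eq_commEval, map_zero, mul_zero, zero_mul]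

end WittLoc

namespace WittLoc

/-! ### Multiplicative filtrations -/

/-- An increasing multiplicative filtration indexed by `ℤ`. -/
structure IsMulFil {A : Type*} [Ring A] [Algebra ℂ A] (S : ℤ → Submodule ℂ A) : Prop where
  mono : Monotone S
  one_mem : (1 : A) ∈ S 0
  mul_mem : ∀ {d e a b}, a ∈ S d → b ∈ S e → a * b ∈ S (d + e)

theorem isMulFil_letterFil {A ι : Type*} [Ring A] [Algebra ℂ A] (x : ι → A) (w : ι → ℤ) :
    IsMulFil (letterFil ℂ x w) where
  mono _ _ h := letterFil_mono h
  one_mem := one_mem_letterFil le_rfl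
  mul_mem ha hb := mul_mem_letterFil ha hb le_rfl

namespace IsMulFil

variable {A : Type*} [Ring A] [Algebra ℂ A] {S : ℤ → Submodule ℂ A}

theorem list_prod_mem (hS : IsMulFil S) {ι : Type*} {x : ι → A} {w : ι → ℤ}
    (h : ∀ i, x i ∈ S (w i)) (l : List ι) : (l.map x).prod ∈ S (l.map w).sum := by
  induction l with
  | nil => simpa using hS.one_mem
  | cons i l ih => simpa using hS.mul_mem (h i) ih

theorem letterFil_le (hS : IsMulFil S) {ι : Type*} {x : ι → A} {w : ι → ℤ}
    (h : ∀ i, x i ∈ S (w i)) (d : ℤ) : letterFil ℂ x w d ≤ S d := by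
  refine Submodule.span_le.2 ?_
  rintro _ ⟨l, hl, rfl⟩
  exact hS.mono hl (hS.list_prod_mem h l)

theorem prod_ofFn_mem (hS : IsMulFil S) {n : ℕ} {f : Fin n → A} {w : Fin n → ℤ}
    (h : ∀ i, f i ∈ S (w i)) : (List.ofFn f).prod ∈ S (∑ i, w i) := by
  have := hS.list_prod_mem h (List.finRange n)
  rwa [← List.ofFn_eq_map, ← List.ofFn_eq_map, List.sum_ofFn] at this

theorem pow_mem (hS : IsMulFil S) {a : A} {d : ℤ} (h : a ∈ S d) (k : ℕ) : a ^ k ∈ S (k * d) := by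
  induction k with
  | zero => simpa using hS.one_mem
  | succ k ih =>
    rw [pow_succ]
    convert hS.mul_mem ih h using 2
    push_cast; ring

theorem zpow_mem (hS : IsMulFil S) {u : Aˣ} {d : ℤ} (h : (u : A) ∈ S d)
    (h' : (u⁻¹ : Aˣ).val ∈ S (-d)) (k : ℤ) : (u ^ k : Aˣ).val ∈ S (k * d) := by
  cases k with
  | ofNat k => simpa using hS.pow_mem h k
  | negSucc k =>
    have := hS.pow_mem h' (k + 1)
    rw [← Units.val_pow_eq_pow_val, inv_pow] at this
    rw [zpow_negSucc]
    convert this using 2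
    rw [Int.negSucc_eq]
    push_cast; ring

variable {n : ℕ} {S : ℤ → Submodule ℂ (Uloc n)}

theorem delPow_mem (hS : IsMulFil S) {κ : ℤ} (h : ∀ i : Fin n, (delUnit i : Uloc n) ∈ S κ)
    (h' : ∀ i : Fin n, ((delUnit i)⁻¹ : (Uloc n)ˣ).val ∈ S (-κ)) (a : Fin n → ℤ) :
    delPow a ∈ S ((∑ i, a i) * κ) := by
  rw [delPow, ← Units.coeHom_apply, map_list_prod, List.map_ofFn, Finset.sum_mul]
  exact hS.prod_ofFn_mem fun i => hS.zpow_mem (h i) (h' i) (a i)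

theorem polyH_mem (hS : IsMulFil S) (h : ∀ i : Fin n, (hElt i : Uloc n) ∈ S 1)
    (g : MvPolynomial (Fin n) ℂ) : polyH g ∈ S g.totalDegree := by
  refine Submodule.sum_mem _ fun s hs => Submodule.smul_mem _ _ ?_
  refine hS.mono ?_ (hS.prod_ofFn_mem fun i => hS.pow_mem (h i) (s i))
  have := MvPolynomial.le_totalDegree hs
  rw [Finsupp.sum_fintype _ _ fun _ => rfl] at this
  simpa using Int.ofNat_le.2 this

end IsMulFil

theorem sum_sub_single {n : ℕ} (m : Fin n →₀ ℕ) (j : Fin n) :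
    ∑ k, ((m k : ℤ) - (Finsupp.single j 1 k : ℕ)) = m.degree - 1 := by
  rw [Finset.sum_sub_distrib, Finsupp.degree_eq_sum]
  congr 1
  · push_cast; rfl
  · rw [← Nat.cast_sum, ← Finsupp.degree_eq_sum, Finsupp.degree_single, Nat.cast_one]

variable {n : ℕ}

/-! ### Weights on the generators of the localization -/

/-- The generators `t^m ∂_j` and `∂_i⁻¹` of the localization. -/
noncomputable def locGen : ((Fin n →₀ ℕ) × Fin n) ⊕ Fin n → Uloc n :=
  Sum.elim (fun p => toUloc (vf p.1 p.2)) fun i => ((delUnit i)⁻¹ : (Uloc n)ˣ)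

/-- Weights on the generators for which commutators drop the weight. -/
structure IsAdmissible (w : ((Fin n →₀ ℕ) × Fin n) ⊕ Fin n → ℤ) : Prop where
  bracket : ∀ (m s : Fin n →₀ ℕ) (i j : Fin n), s i ≠ 0 →
    ¬ (m = Finsupp.single i 1 ∧ s = Finsupp.single j 1) →
    w (.inl (m + s - Finsupp.single i 1, j)) ≤ w (.inl (m, i)) + w (.inl (s, j)) - 1
  inv : ∀ i, w (.inr i) = -w (.inl (0, i))

namespace IsAdmissible

variable {w : ((Fin n →₀ ℕ) × Fin n) ⊕ Fin n → ℤ}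

theorem smul_vf_mem_span {s m : Fin n →₀ ℕ} {i j : Fin n} {d : ℤ}
    (h : s i ≠ 0 → w (.inl (m, j)) ≤ d) :
    (s i : ℂ) • (vf m j : W n) ∈ Submodule.span ℂ
      ((fun p : (Fin n →₀ ℕ) × Fin n => (vf p.1 p.2 : W n)) '' {p | w (.inl p) ≤ d}) := by
  rcases eq_or_ne (s i) 0 with h0 | h0
  · rw [h0, Nat.cast_zero, zero_smul]
    exact zero_mem _
  · exact Submodule.smul_mem _ _ (Submodule.subset_span ⟨(m, j), h h0, rfl⟩)

theorem bracket_vf_mem_span (hw : IsAdmissible w) (p q : (Fin n →₀ ℕ) × Fin n) :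
    ⁅(vf p.1 p.2 : W n), vf q.1 q.2⁆ ∈ Submodule.span ℂ
      ((fun p : (Fin n →₀ ℕ) × Fin n => (vf p.1 p.2 : W n)) ''
        {r | w (.inl r) ≤ w (.inl p) + w (.inl q) - 1}) := by
  obtain ⟨m, i⟩ := p
  obtain ⟨s, j⟩ := q
  rw [bracket_vf]
  by_cases h : m = Finsupp.single i 1 ∧ s = Finsupp.single j 1
  -- The pair excluded from the weight condition is [h_i, h_j] = 0.
  · obtain ⟨rfl, rfl⟩ := h
    rcases eq_or_ne i j with rfl | h
    · rw [sub_self]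
      exact zero_mem _
    · rw [Finsupp.single_eq_of_ne h, Finsupp.single_eq_of_ne h.symm, Nat.cast_zero, zero_smul,
        zero_smul, sub_zero]
      exact zero_mem _
  · refine sub_mem (smul_vf_mem_span fun hs => hw.bracket m s i j hs h)
      (smul_vf_mem_span fun hm => ?_)
    have := hw.bracket s m j i hm fun h' => h h'.symm
    rw [add_comm s m] at this
    dsimp only
    omega

theorem smul_mem {m : Fin n →₀ ℕ} {j i : Fin n} {d : ℤ} {s : Fin n →₀ ℕ}
    (h : s i ≠ 0 → w (.inl (m, j)) ≤ d) :
    (s i : ℂ) • toUloc (vf m j) ∈ letterFil ℂ locGen w d := by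
  rcases eq_or_ne (s i) 0 with h0 | h0
  · rw [h0, Nat.cast_zero, zero_smul]
    exact zero_mem _
  · exact Submodule.smul_mem _ _ (letter_mem_letterFil (x := locGen) (Sum.inl (m, j)) (h h0))

theorem commutator_vf_mem (hw : IsAdmissible w) (p q : (Fin n →₀ ℕ) × Fin n) :
    toUloc (vf p.1 p.2) * toUloc (vf q.1 q.2) - toUloc (vf q.1 q.2) * toUloc (vf p.1 p.2) ∈
      letterFil ℂ locGen w (w (.inl p) + w (.inl q) - 1) := by
  rw [toUloc_bracket, ← toUlocₗ_apply]
  refine (Submodule.span_le (p := (letterFil ℂ locGen w _).comap (toUlocₗ n))).2 ?_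
    (hw.bracket_vf_mem_span p q)
  rintro _ ⟨r, hr, rfl⟩
  exact letter_mem_letterFil (x := locGen) (Sum.inl r) hr

/-- The identity [x, ∂⁻¹] = ∂⁻¹ [∂, x] ∂⁻¹ reduces to the bracket with ∂_i; the two inverses
contribute -2 w(∂_i). -/
theorem commutator_vf_inv_mem (hw : IsAdmissible w) (q : (Fin n →₀ ℕ) × Fin n) (i : Fin n) :
    toUloc (vf q.1 q.2) * ((delUnit i)⁻¹ : (Uloc n)ˣ) -
      ((delUnit i)⁻¹ : (Uloc n)ˣ) * toUloc (vf q.1 q.2) ∈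
      letterFil ℂ locGen w (w (.inl q) + w (.inr i) - 1) := by
  obtain ⟨s, j⟩ := q
  have h1 : toUloc (vf s j) * ((delUnit i)⁻¹ : (Uloc n)ˣ) -
      ((delUnit i)⁻¹ : (Uloc n)ˣ) * toUloc (vf s j) = ((delUnit i)⁻¹ : (Uloc n)ˣ) *
        ((s i : ℂ) • toUloc (vf (s - Finsupp.single i 1) j)) * ((delUnit i)⁻¹ : (Uloc n)ˣ) := by
    have h2 := delUnit_mul_toUloc s i j
    rw [add_comm, ← sub_eq_iff_eq_add] at h2
    rw [← h2, mul_sub, sub_mul, Units.inv_mul_cancel_left, mul_assoc, Units.mul_inv_cancel_right]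
  have h3 : ((delUnit i)⁻¹ : (Uloc n)ˣ).val ∈ letterFil ℂ locGen w (w (.inr i)) :=
    letter_mem_letterFil (x := locGen) (Sum.inr i) le_rfl
  change toUloc (vf s j) * ((delUnit i)⁻¹ : (Uloc n)ˣ) -
      ((delUnit i)⁻¹ : (Uloc n)ˣ) * toUloc (vf s j) ∈ _
  rw [h1]
  have h4 : (s i : ℂ) • toUloc (vf (s - Finsupp.single i 1) j) ∈
      letterFil ℂ locGen w (w (.inl (0, i)) + w (.inl (s, j)) - 1) := smul_mem fun hs => by
    have := hw.bracket 0 s i j hs fun h => by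
      have := DFunLike.congr_fun h.1 i
      simp at this
    rwa [zero_add] at this
  have := hw.inv i
  exact mul_mem_letterFil (mul_mem_letterFil h3 h4 le_rfl) h3 (by omega)

theorem commutator_mem (hw : IsAdmissible w) (i j : ((Fin n →₀ ℕ) × Fin n) ⊕ Fin n) :
    locGen i * locGen j - locGen j * locGen i ∈ letterFil ℂ locGen w (w i + w j - 1) := by
  rcases i with p | i <;> rcases j with q | j
  · exact hw.commutator_vf_mem p q
  · exact hw.commutator_vf_inv_mem p j
  · rw [add_comm (w _)]
    have := neg_mem (hw.commutator_vf_inv_mem q i)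
    rwa [neg_sub] at this
  · have : locGen (Sum.inr i) * locGen (Sum.inr j) -
        locGen (Sum.inr j) * locGen (Sum.inr i) = (0 : Uloc n) := by
      rw [sub_eq_zero]
      exact congrArg Units.val (commute_delUnit i j).inv_inv.eq
    rw [this]
    exact zero_mem _

end IsAdmissible

/-- The weights `1` of `t^m ∂_j` and `-1` of `∂_i⁻¹`. -/
def ordWeight : ((Fin n →₀ ℕ) × Fin n) ⊕ Fin n → ℤ := Sum.elim (fun _ => 1) fun _ => -1

theorem isAdmissible_ordWeight : IsAdmissible (ordWeight (n := n)) where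
  bracket _ _ _ _ _ _ := by simp [ordWeight]
  inv _ := by simp [ordWeight]

theorem term_mem {S : ℤ → Submodule ℂ (Uloc n)} (hS : IsMulFil S) {κ : ℤ}
    (h1 : ∀ i : Fin n, (delUnit i : Uloc n) ∈ S κ)
    (h2 : ∀ i : Fin n, ((delUnit i)⁻¹ : (Uloc n)ˣ).val ∈ S (-κ)) (h3 : ∀ i : Fin n, (hElt i : Uloc n) ∈ S 1)
    {r : Fin n →₀ ℕ} {j : Fin n} {e : ℤ} (h4 : toUloc (vf r j) ∈ S e)
    (g : MvPolynomial (Fin n) ℂ) {d : ℤ}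
    (hd : e + g.totalDegree + ((r.degree : ℤ) - 1) * κ ≤ d) : term r j g ∈ S d := by
  have h := hS.delPow_mem h1 h2 fun k => (r k : ℤ) - (Finsupp.single j 1 k : ℕ)
  rw [sum_sub_single] at h
  exact hS.mono hd (hS.mul_mem (hS.mul_mem h4 (hS.polyH_mem h3 g)) h)

theorem mem_range_finsuppAntidiag_iff {d : ℕ} {r : Fin n →₀ ℕ} :
    r ∈ Finset.univ.finsuppAntidiag d ↔ r.degree = d := by
  rw [Finset.mem_finsuppAntidiag, Finsupp.degree_eq_sum]
  simp

theorem delUnit_mem_ordFil (i : Fin n) : (delUnit i : Uloc n) ∈ letterFil ℂ locGen ordWeight 1 := by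
  rw [val_delUnit]
  exact letter_mem_letterFil (x := locGen) (Sum.inl (0, i)) le_rfl

/-- The leading term has weight 1 + (|m| - 1), and the term with index r at most 1 + (|m| - |r|) +
(|r| - 1); both equal |m|. -/
theorem mem_ordFil_of_hasLeadingTerm {m : Fin n →₀ ℕ} {j : Fin n} {x : Uloc n}
    (hx : HasLeadingTerm m j x) : x ∈ letterFil ℂ locGen ordWeight m.degree := by
  have hS := isMulFil_letterFil (locGen (n := n)) ordWeight
  have h2 : ∀ i, ((delUnit i)⁻¹ : (Uloc n)ˣ).val ∈ letterFil ℂ locGen ordWeight (-1) := fun i =>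
    letter_mem_letterFil (x := locGen) (Sum.inr i) le_rfl
  have h3 : ∀ r j, (toUloc (vf r j) : Uloc n) ∈ letterFil ℂ locGen ordWeight 1 := fun r j =>
    letter_mem_letterFil (x := locGen) (Sum.inl (r, j)) le_rfl
  obtain ⟨g, hg, rfl⟩ := hx
  refine add_mem ?_ (Submodule.sum_mem _ fun d hd => Submodule.sum_mem _ fun r hr => ?_)
  · have h := hS.delPow_mem delUnit_mem_ordFil h2 fun k => (m k : ℤ) - (Finsupp.single j 1 k : ℕ)
    rw [sum_sub_single] at h
    exact hS.mono (by omega) (hS.mul_mem (h3 m j) h)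
  · rw [mem_range_finsuppAntidiag_iff] at hr
    subst hr
    have := hg r (Finset.mem_range.1 hd)
    have := Finset.mem_range.1 hd
    exact term_mem hS delUnit_mem_ordFil h2 (fun i => h3 _ _) (h3 r j) _ (by omega)

/-- The localization is exhausted by the filtration `letterFil ℂ locGen ordWeight`. -/
theorem exists_mem_ordFil (u : Uloc n) : ∃ d, u ∈ letterFil ℂ locGen ordWeight d := by
  have hS := isMulFil_letterFil (locGen (n := n)) ordWeight
  let B : Subalgebra ℂ (Uloc n) :=
    { carrier := {u | ∃ d, u ∈ letterFil ℂ locGen ordWeight d}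
      mul_mem' := fun ⟨d, hd⟩ ⟨e, he⟩ => ⟨d + e, hS.mul_mem hd he⟩
      add_mem' := fun ⟨d, hd⟩ ⟨e, he⟩ => ⟨max d e, add_mem (hS.mono (le_max_left _ _) hd)
        (hS.mono (le_max_right _ _) he)⟩
      algebraMap_mem' := fun c => ⟨0, by
        rw [Algebra.algebraMap_eq_smul_one]
        exact Submodule.smul_mem _ _ hS.one_mem⟩ }
  change u ∈ B
  have h1 : ∀ x : W n, toUloc x ∈ B := by
    intro x
    have hx : x ∈ Submodule.span ℂ
        (Set.range fun p : (Fin n →₀ ℕ) × Fin n => (vf p.1 p.2 : W n)) := span_vf ▸ trivial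
    have : Submodule.span ℂ (Set.range fun p : (Fin n →₀ ℕ) × Fin n => (vf p.1 p.2 : W n)) ≤
        B.toSubmodule.comap (toUlocₗ n) := by
      refine Submodule.span_le.2 ?_
      rintro _ ⟨p, rfl⟩
      exact ⟨1, letter_mem_letterFil (x := locGen) (Sum.inl p) le_rfl⟩
    exact this hx
  have h2 : ∀ r : U n, num n r ∈ B := by
    intro r
    obtain ⟨a, rfl⟩ : ∃ a, UniversalEnvelopingAlgebra.mkAlgHom ℂ (W n) a = r :=
      RingCon.mk'_surjective (UniversalEnvelopingAlgebra.ringCon ℂ (W n)) r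
    induction a using TensorAlgebra.induction with
    | algebraMap c => rw [AlgHom.commutes, AlgHom.commutes]; exact B.algebraMap_mem c
    | ι x => exact h1 x
    | mul a b ha hb => rw [map_mul, map_mul]; exact B.mul_mem ha hb
    | add a b ha hb => rw [map_add, map_add]; exact B.add_mem ha hb
  -- `B` contains left inverses of all denominators, so it contains every fraction.
  have h3 : ∀ s ∈ delMonoid n, ∃ b ∈ B, b * num n s = 1 := by
    intro s hs
    induction hs using Submonoid.closure_induction with
    | mem s hs =>
      obtain ⟨i, rfl⟩ := hs
      exact ⟨((delUnit i)⁻¹ : (Uloc n)ˣ), ⟨-1, letter_mem_letterFil (x := locGen) (Sum.inr i) le_rfl⟩,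
        Units.inv_mul (delUnit i)⟩
    | one => exact ⟨1, B.one_mem, by rw [map_one, mul_one]⟩
    | mul x y _ _ hx hy =>
      obtain ⟨b, hb, hbx⟩ := hx
      obtain ⟨c, hc, hcy⟩ := hy
      refine ⟨c * b, B.mul_mem hc hb, ?_⟩
      rw [map_mul, mul_assoc, ← mul_assoc b, hbx, one_mul, hcy]
  induction u using OreLocalization.ind with
  | _ r s =>
    obtain ⟨b, hb, hbs⟩ := h3 s s.2
    have h4 : num n s * (r /ₒ s) = num n r := OreLocalization.mul_cancel
    rw [← one_mul (r /ₒ s), ← hbs, mul_assoc, h4]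
    exact B.mul_mem hb (h2 r)

end WittLoc

namespace WittLoc

/-! ### Elements commuting with a Weyl pair -/

section WeylPair

variable {A : Type*} [Ring A] [Algebra ℂ A]

theorem commutator_pow_of_commutator_one {d T : A} (h : d * T = T * d + 1) (k : ℕ) :
    d * T ^ k = T ^ k * d + (k : ℂ) • T ^ (k - 1) := by
  induction k with
  | zero => simp
  | succ k ih =>
    rw [pow_succ, ← mul_assoc, ih, add_mul, mul_assoc, h, mul_add, mul_one, ← mul_assoc,
      Nat.add_sub_cancel, Nat.cast_succ, add_smul, one_smul, smul_mul_assoc, add_assoc,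
      add_comm (T ^ k)]
    rcases Nat.eq_zero_or_pos k with rfl | hk
    · simp
    · rw [pow_sub_one_mul hk.ne']

/-- With coefficients commuting with `d`, ad d acts as the formal derivative in `T`. -/
theorem commutator_sum_pow_mul {d T : A} (h : d * T = T * d + 1) {e : ℕ → A}
    (he : ∀ b, Commute d (e b)) (N : ℕ) :
    d * (∑ b ∈ Finset.range (N + 1), T ^ b * e b) - (∑ b ∈ Finset.range (N + 1), T ^ b * e b) * d =
      ∑ b ∈ Finset.range N, T ^ b * ((b + 1 : ℂ) • e (b + 1)) := by
  have h1 : ∀ b, d * (T ^ b * e b) - T ^ b * e b * d = (b : ℂ) • (T ^ (b - 1) * e b) := by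
    intro b
    rw [← mul_assoc, commutator_pow_of_commutator_one h, add_mul, mul_assoc, (he b).eq, ← mul_assoc,
      add_sub_cancel_left, smul_mul_assoc]
  rw [Finset.mul_sum, Finset.sum_mul, ← Finset.sum_sub_distrib, Finset.sum_range_succ', h1]
  simp only [h1, Nat.cast_zero, zero_smul, add_zero, Nat.add_sub_cancel, mul_smul_comm,
    Nat.cast_succ]

/-- Differentiating a vanishing polynomial in `T` lowers its degree; induction kills all
coefficients but the constant one, which then vanishes too. -/
theorem eq_zero_of_sum_pow_mul_eq_zero {d T : A} (h : d * T = T * d + 1) (N : ℕ) :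
    ∀ e : ℕ → A, (∀ b, Commute d (e b)) → ∑ b ∈ Finset.range N, T ^ b * e b = 0 →
      ∀ b < N, e b = 0 := by
  induction N with
  | zero => intro _ _ _ b hb; omega
  | succ N ih =>
    intro e he hsum
    have h1 := commutator_sum_pow_mul h he N
    rw [hsum, mul_zero, zero_mul, sub_zero] at h1
    have h2 := ih (fun b => (b + 1 : ℂ) • e (b + 1)) (fun b => (he _).smul_right _) h1.symm
    have h3 : ∀ b < N, e (b + 1) = 0 := fun b hb =>
      (smul_eq_zero.1 (h2 b hb)).resolve_left (Nat.cast_add_one_ne_zero b)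
    rintro (_ | b) hb
    · rw [Finset.sum_range_succ', Finset.sum_eq_zero fun b hb => by
        rw [h3 b (Finset.mem_range.1 hb), mul_zero], zero_add, pow_zero, one_mul] at hsum
      exact hsum
    · exact h3 b (by omega)

/-- If `[d, T] = 1` and `d` commutes with `E`, the elements of `∑_b T^b E` commuting with `d` lie in
`E`. -/
theorem mem_of_mem_span_pow_mul {d T : A} (h : d * T = T * d + 1) (E : Submodule ℂ A)
    (hE : ∀ e ∈ E, Commute d e) {u : A}
    (hu : u ∈ Submodule.span ℂ {z | ∃ b : ℕ, ∃ e ∈ E, T ^ b * e = z}) (hd : Commute d u) :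
    u ∈ E := by
  have h1 : ∃ f : ℕ →₀ A, (∀ b, f b ∈ E) ∧ f.sum (fun b e => T ^ b * e) = u := by
    clear hd
    induction hu using Submodule.span_induction with
    | mem z hz =>
      obtain ⟨b, e, he, rfl⟩ := hz
      refine ⟨Finsupp.single b e, fun c => ?_, Finsupp.sum_single_index (mul_zero _)⟩
      rw [Finsupp.single_apply]
      split_ifs
      · exact he
      · exact zero_mem _
    | zero => exact ⟨0, fun _ => zero_mem _, rfl⟩
    | add p q _ _ hp hq =>
      obtain ⟨f, hf, rfl⟩ := hp
      obtain ⟨g, hg, rfl⟩ := hq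
      exact ⟨f + g, fun b => add_mem (hf b) (hg b),
        Finsupp.sum_add_index' (fun _ => mul_zero _) fun _ _ _ => mul_add _ _ _⟩
    | smul c p _ hp =>
      obtain ⟨f, hf, rfl⟩ := hp
      refine ⟨c • f, fun b => Submodule.smul_mem _ _ (hf b), ?_⟩
      rw [Finsupp.sum_smul_index' fun _ => mul_zero _, Finsupp.smul_sum]
      simp only [mul_smul_comm]
  obtain ⟨f, hf, hfu⟩ := h1
  obtain ⟨N, hN⟩ : ∃ N, f.support ⊆ Finset.range (N + 1) :=
    ⟨f.support.sup id, fun b hb => Finset.mem_range.2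
      (Nat.lt_succ_of_le (Finset.le_sup (f := id) hb))⟩
  rw [Finsupp.sum_of_support_subset _ hN _ fun _ _ => mul_zero _] at hfu
  have h2 := commutator_sum_pow_mul h (fun b => hE _ (hf b)) N
  rw [hfu, hd.eq, sub_self] at h2
  have h3 := eq_zero_of_sum_pow_mul_eq_zero h N (fun b => (b + 1 : ℂ) • f (b + 1))
    (fun b => (hE _ (hf _)).smul_right _) h2.symm
  rw [← hfu, Finset.sum_range_succ', Finset.sum_eq_zero fun b hb => by
    rw [(smul_eq_zero.1 (h3 b (Finset.mem_range.1 hb))).resolve_left (Nat.cast_add_one_ne_zero b),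
      mul_zero], zero_add, pow_zero, one_mul]
  exact hf 0

/-- An element commuting with `h` that is a sum of an element of `C` commuting with `h` and of
eigenvectors of `ad h` for nonzero eigenvalues lies in `C`. -/
theorem mem_of_mem_sup_eigen {h : A} (C : Submodule ℂ A) (hC : ∀ c ∈ C, Commute h c) {u : A}
    (hu : u ∈ C ⊔ Submodule.span ℂ {z | ∃ μ : ℂ, μ ≠ 0 ∧ IsAdEigen h z μ}) (hh : Commute h u) :
    u ∈ C := by
  -- This is ad h; independence of its eigenspaces separates eigenvalue 0 from the others.
  set D : Module.End ℂ A := LinearMap.mulLeft ℂ h - LinearMap.mulRight ℂ h with hD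
  have hmem : ∀ (z : A) (μ : ℂ), z ∈ D.eigenspace μ ↔ IsAdEigen h z μ := fun z μ =>
    Module.End.mem_eigenspace_iff
  have hcomm : ∀ z, Commute h z → z ∈ D.eigenspace 0 := fun z hz =>
    (hmem z 0).2 (IsAdEigen.of_commute hz)
  obtain ⟨c, hc, v, hv, rfl⟩ := Submodule.mem_sup.1 hu
  have h1 : v ∈ ⨆ μ, ⨆ _ : μ ≠ 0, D.eigenspace μ := by
    refine Submodule.span_le.2 ?_ hv
    rintro z ⟨μ, hμ, hz⟩
    exact Submodule.mem_iSup_of_mem μ (Submodule.mem_iSup_of_mem hμ ((hmem z μ).2 hz))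
  have h2 : v ∈ D.eigenspace 0 := by
    have := sub_mem (hcomm _ hh) (hcomm _ (hC c hc))
    rwa [add_sub_cancel_left] at this
  have h3 : v = 0 := Submodule.disjoint_def.1 (D.eigenspaces_iSupIndep 0) v h2 h1
  rwa [h3, add_zero]

end WeylPair

variable {n : ℕ}

/-! ### Expansions over the centralizer -/

theorem hElt_eq (i : Fin n) : (hElt i : Uloc n) = tElt i * delUnit i := (tElt_mul_delUnit i).symm

theorem delUnit_mul_tElt_self (i : Fin n) :
    (delUnit i : Uloc n) * tElt i = tElt i * delUnit i + 1 := by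
  rw [delUnit_mul_tElt, if_pos rfl]

theorem commute_delUnit_tElt {i j : Fin n} (h : i ≠ j) : Commute (delUnit i : Uloc n) (tElt j) := by
  have := delUnit_mul_tElt i j
  rwa [if_neg h, add_zero] at this

theorem commute_coe_delUnit (i j : Fin n) : Commute (delUnit i : Uloc n) (delUnit j) :=
  congrArg Units.val (commute_delUnit i j).eq

theorem commute_tElt_of_mem_H {u : Uloc n} (hu : u ∈ H n) (i : Fin n) : Commute (tElt i) u := by
  rw [mem_H_iff] at hu
  rw [tElt, zpow_neg_one]
  exact (hu.2 i).mul_left (hu.1 i).units_inv_left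

/-- The span of the products `c T^b ∂^a` with `c ∈ F`, where `T_i` and `∂_i` run over the indices in
a list, filtered by the total degree in the `∂_i`. -/
noncomputable def colFil (F : ℤ → Submodule ℂ (Uloc n)) : List (Fin n) → ℤ → Submodule ℂ (Uloc n)
  | [], d => F d
  | i :: l, d => Submodule.span ℂ {z | ∃ (c : Uloc n) (b : ℕ) (k : ℤ), c ∈ colFil F l (d - k) ∧
      c * (tElt i ^ b * (delUnit i ^ k : (Uloc n)ˣ)) = z}

variable {F : ℤ → Submodule ℂ (Uloc n)}

theorem colFil_mono (hF : Monotone F) (l : List (Fin n)) : Monotone (colFil F l) := by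
  induction l with
  | nil => exact hF
  | cons i l ih =>
    intro d e h
    refine Submodule.span_mono ?_
    rintro z ⟨c, b, k, hc, rfl⟩
    exact ⟨c, b, k, ih (by omega) hc, rfl⟩

theorem le_colFil (l : List (Fin n)) (d : ℤ) : F d ≤ colFil F l d := by
  induction l with
  | nil => exact le_rfl
  | cons i l ih =>
    intro c hc
    refine Submodule.subset_span ⟨c, 0, 0, ?_, by simp⟩
    rw [sub_zero]
    exact ih hc

theorem commute_of_mem_colFil (l : List (Fin n)) (a : Uloc n) (h1 : ∀ d, ∀ c ∈ F d, Commute a c)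
    (h2 : ∀ i ∈ l, Commute a (tElt i)) (h3 : ∀ i ∈ l, Commute a (delUnit i)) {d : ℤ} {c : Uloc n}
    (hc : c ∈ colFil F l d) : Commute a c := by
  induction l generalizing d c with
  | nil => exact h1 d c hc
  | cons i l ih =>
    induction hc using Submodule.span_induction with
    | mem z hz =>
      obtain ⟨c, b, k, hc, rfl⟩ := hz
      refine (ih (fun j hj => h2 j (List.mem_cons_of_mem _ hj))
        (fun j hj => h3 j (List.mem_cons_of_mem _ hj)) hc).mul_right (Commute.mul_right ?_ ?_)
      · exact (h2 i List.mem_cons_self).pow_right b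
      · exact (h3 i List.mem_cons_self).units_zpow_right k
    | zero => exact Commute.zero_right _
    | add p q _ _ hp hq => exact hp.add_right hq
    | smul r p _ hp => exact hp.smul_right r

/-- Right multiplication by elements commuting with the `T_i` and `∂_i` preserves `colFil F l`
whenever it preserves `F`. -/
theorem mul_mem_colFil_of_commute (l : List (Fin n)) {x : Uloc n} {e : ℤ}
    (h1 : ∀ d, ∀ c ∈ F d, c * x ∈ F (d + e))
    (h2 : ∀ i ∈ l, Commute (tElt i) x) (h3 : ∀ i ∈ l, Commute (delUnit i : Uloc n) x) {d : ℤ}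
    {c : Uloc n} (hc : c ∈ colFil F l d) : c * x ∈ colFil F l (d + e) := by
  induction l generalizing d c with
  | nil => exact h1 d c hc
  | cons i l ih =>
    induction hc using Submodule.span_induction with
    | mem z hz =>
      obtain ⟨c, b, k, hc, rfl⟩ := hz
      refine Submodule.subset_span ⟨c * x, b, k, ?_, ?_⟩
      · have := ih (fun j hj => h2 j (List.mem_cons_of_mem _ hj))
          (fun j hj => h3 j (List.mem_cons_of_mem _ hj)) hc
        rwa [sub_add_eq_add_sub] at this
      · have h4 : Commute (tElt i ^ b * (delUnit i ^ k : (Uloc n)ˣ)) x :=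
          ((h2 i List.mem_cons_self).pow_left b).mul_left
            ((h3 i List.mem_cons_self).units_zpow_left k)
        rw [mul_assoc, mul_assoc, h4.eq]
    | zero => rw [zero_mul]; exact zero_mem _
    | add p q _ _ hp hq => rw [add_mul]; exact add_mem hp hq
    | smul r p _ hp => rw [smul_mul_assoc]; exact Submodule.smul_mem _ _ hp

/-- Obtained from the ad h_i eigenvalue of ∂_i^k, which treats positive and negative `k` alike. -/
theorem zpow_mul_tElt (i : Fin n) (k : ℤ) :
    ((delUnit i ^ k : (Uloc n)ˣ) : Uloc n) * tElt i =
      tElt i * (delUnit i ^ k : (Uloc n)ˣ) + (k : ℂ) • ((delUnit i ^ (k - 1) : (Uloc n)ˣ) : Uloc n) := by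
  have h := isAdEigen_delPow i (Pi.single i k)
  rw [delPow_single, Pi.single_eq_same, IsAdEigen, neg_smul, sub_eq_iff_eq_add, neg_add_eq_sub,
    eq_sub_iff_add_eq] at h
  have h' : tElt i = (hElt i : Uloc n) * (delUnit i ^ (-1 : ℤ) : (Uloc n)ˣ) := rfl
  have h2 : ((delUnit i ^ (-1 : ℤ) : (Uloc n)ˣ) : Uloc n) * (delUnit i ^ k : (Uloc n)ˣ) =
      (delUnit i ^ k : (Uloc n)ˣ) * (delUnit i ^ (-1 : ℤ) : (Uloc n)ˣ) := by
    rw [← Units.val_mul, ← Units.val_mul, ← zpow_add, ← zpow_add, add_comm]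
  have h3 : ((delUnit i ^ (k - 1) : (Uloc n)ˣ) : Uloc n) =
      (delUnit i ^ k : (Uloc n)ˣ) * (delUnit i ^ (-1 : ℤ) : (Uloc n)ˣ) := by
    rw [← Units.val_mul, ← zpow_add, sub_eq_add_neg]
  rw [h', ← mul_assoc, ← h, add_mul, smul_mul_assoc, ← h3, mul_assoc, mul_assoc, h2]

theorem mul_tElt_mem_colFil (hF : Monotone F) (l : List (Fin n)) {i : Fin n} (hi : i ∈ l) {d : ℤ} {c : Uloc n} (hc : c ∈ colFil F l d) :
    c * tElt i ∈ colFil F l d := by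
  induction l generalizing d c with
  | nil => simp at hi
  | cons j l ih =>
    induction hc using Submodule.span_induction with
    | mem z hz =>
      obtain ⟨c, b, k, hc, rfl⟩ := hz
      rcases eq_or_ne i j with rfl | hij
      · rw [mul_assoc, mul_assoc, zpow_mul_tElt, mul_add, mul_add, ← mul_assoc (tElt i ^ b),
          ← pow_succ, mul_smul_comm, mul_smul_comm]
        refine add_mem (Submodule.subset_span ⟨c, b + 1, k, hc, rfl⟩) (Submodule.smul_mem _ _
          (Submodule.subset_span ⟨c, b, k - 1, colFil_mono hF l (by omega) hc, rfl⟩))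
      · have h : Commute (tElt j ^ b * (delUnit j ^ k : (Uloc n)ˣ)) (tElt i) :=
          ((commute_tElt j i).pow_left b).mul_left
            ((commute_delUnit_tElt hij.symm).units_zpow_left k)
        rw [mul_assoc, h.eq, ← mul_assoc]
        exact Submodule.subset_span ⟨c * tElt i, b, k,
          ih ((List.mem_cons.1 hi).resolve_left hij) hc, rfl⟩
    | zero => rw [zero_mul]; exact zero_mem _
    | add p q _ _ hp hq => rw [add_mul]; exact add_mem hp hq
    | smul r p _ hp => rw [smul_mul_assoc]; exact Submodule.smul_mem _ _ hp

theorem mul_zpow_mem_colFil (l : List (Fin n)) {i : Fin n} (hi : i ∈ l) (a : ℤ) {d : ℤ}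
    {c : Uloc n} (hc : c ∈ colFil F l d) :
    c * (delUnit i ^ a : (Uloc n)ˣ) ∈ colFil F l (d + a) := by
  induction l generalizing d c with
  | nil => simp at hi
  | cons j l ih =>
    induction hc using Submodule.span_induction with
    | mem z hz =>
      obtain ⟨c, b, k, hc, rfl⟩ := hz
      rcases eq_or_ne i j with rfl | hij
      · rw [mul_assoc, mul_assoc, ← Units.val_mul, ← zpow_add]
        exact Submodule.subset_span ⟨c, b, k + a, by rwa [add_sub_add_right_eq_sub], rfl⟩
      · have h : Commute (tElt j ^ b * (delUnit j ^ k : (Uloc n)ˣ))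
            ((delUnit i ^ a : (Uloc n)ˣ) : Uloc n) :=
          ((commute_delUnit_tElt hij).symm.pow_left b |>.units_zpow_right a).mul_left
            (congrArg Units.val ((commute_delUnit j i).zpow_zpow k a).eq)
        rw [mul_assoc, h.eq, ← mul_assoc]
        refine Submodule.subset_span ⟨c * (delUnit i ^ a : (Uloc n)ˣ), b, k, ?_, rfl⟩
        have := ih ((List.mem_cons.1 hi).resolve_left hij) hc
        rwa [sub_add_eq_add_sub] at this
    | zero => rw [zero_mul]; exact zero_mem _
    | add p q _ _ hp hq => rw [add_mul]; exact add_mem hp hq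
    | smul r p _ hp => rw [smul_mul_assoc]; exact Submodule.smul_mem _ _ hp

/-- Two reductions remove the index `i`. Commuting with ∂_i forces degree zero in T_i; then c ∂_i^k
is an eigenvector of ad h_i with eigenvalue -k, so commuting with h_i leaves only k = 0. -/
theorem mem_colFil_tail (hH : ∀ d, F d ≤ (H n).toSubmodule) (i : Fin n) (l : List (Fin n))
    (hi : i ∉ l) {d : ℤ} {u : Uloc n} (hu : u ∈ colFil F (i :: l) d) (huH : u ∈ H n) :
    u ∈ colFil F l d := by
  have hne : ∀ j ∈ l, i ≠ j := fun j hj h => hi (h ▸ hj)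
  have h1 : ∀ {d : ℤ} {c : Uloc n}, c ∈ colFil F l d → Commute (delUnit i : Uloc n) c := fun hc =>
    commute_of_mem_colFil l _ (fun d c hc => (mem_H_iff.1 (hH d hc)).1 i)
      (fun j hj => commute_delUnit_tElt (hne j hj)) (fun j _ => commute_coe_delUnit i j) hc
  have h2 : ∀ {d : ℤ} {c : Uloc n}, c ∈ colFil F l d → Commute (tElt i) c := fun hc =>
    commute_of_mem_colFil l _ (fun d c hc => commute_tElt_of_mem_H (hH d hc) i)
      (fun j _ => commute_tElt i j) (fun j hj => (commute_delUnit_tElt (hne j hj).symm).symm) hc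
  have h3 : ∀ {d : ℤ} {c : Uloc n}, c ∈ colFil F l d → Commute (hElt i) c := fun hc => by
    rw [hElt_eq]
    exact (h2 hc).mul_left (h1 hc)
  set E : Submodule ℂ (Uloc n) := Submodule.span ℂ
    {z | ∃ (c : Uloc n) (k : ℤ), c ∈ colFil F l (d - k) ∧ c * (delUnit i ^ k : (Uloc n)ˣ) = z} with hE
  have h4 : u ∈ E := by
    refine mem_of_mem_span_pow_mul (delUnit_mul_tElt_self i) E ?_ ?_ ((mem_H_iff.1 huH).1 i)
    · intro e he
      induction he using Submodule.span_induction with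
      | mem z hz =>
        obtain ⟨c, k, hc, rfl⟩ := hz
        exact (h1 hc).mul_right ((Commute.refl _).units_zpow_right k)
      | zero => exact Commute.zero_right _
      | add p q _ _ hp hq => exact hp.add_right hq
      | smul r p _ hp => exact hp.smul_right r
    · refine Submodule.span_mono ?_ hu
      rintro z ⟨c, b, k, hc, rfl⟩
      refine ⟨b, c * (delUnit i ^ k : (Uloc n)ˣ), Submodule.subset_span ⟨c, k, hc, rfl⟩, ?_⟩
      rw [← mul_assoc, ← mul_assoc, ((h2 hc).pow_left b).eq]
  refine mem_of_mem_sup_eigen (h := hElt i) (colFil F l d) (fun c hc => h3 hc) ?_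
    ((mem_H_iff.1 huH).2 i)
  refine Submodule.span_le.2 ?_ h4
  rintro z ⟨c, k, hc, rfl⟩
  rcases eq_or_ne k 0 with rfl | hk
  · refine Submodule.mem_sup_left ?_
    rw [sub_zero] at hc
    simpa using hc
  · refine Submodule.mem_sup_right (Submodule.subset_span ⟨-k, by simpa using hk, ?_⟩)
    have := (IsAdEigen.of_commute (h3 hc)).mul (isAdEigen_delPow i (Pi.single i k))
    rwa [delPow_single, Pi.single_eq_same, zero_add] at this

theorem mem_of_mem_colFil (hH : ∀ d, F d ≤ (H n).toSubmodule) (l : List (Fin n)) (hl : l.Nodup)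
    {d : ℤ} {u : Uloc n} (hu : u ∈ colFil F l d) (huH : u ∈ H n) : u ∈ F d := by
  induction l with
  | nil => exact hu
  | cons i l ih =>
    rw [List.nodup_cons] at hl
    exact ih hl.2 (mem_colFil_tail hH i l hl.1 hu huH)

/-! ### Spanning -/

/-- The elements that raise a filtration by at most `e` under right multiplication. -/
def rightMulFil (C : ℤ → Submodule ℂ (Uloc n)) (e : ℤ) : Submodule ℂ (Uloc n) where
  carrier := {z | ∀ d, ∀ c ∈ C d, c * z ∈ C (d + e)}
  zero_mem' d c _ := by rw [mul_zero]; exact zero_mem _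
  add_mem' hp hq d c hc := by rw [mul_add]; exact add_mem (hp d c hc) (hq d c hc)
  smul_mem' r p hp d c hc := by rw [mul_smul_comm]; exact Submodule.smul_mem _ _ (hp d c hc)

theorem isMulFil_rightMulFil {C : ℤ → Submodule ℂ (Uloc n)} (hC : Monotone C) :
    IsMulFil (rightMulFil C) where
  mono d e h z hz a c hc := hC (by omega) (hz a c hc)
  one_mem d c hc := by rwa [mul_one, add_zero]
  mul_mem {d e a b} ha hb f c hc := by
    rw [← mul_assoc, ← add_assoc]
    exact hb _ _ (ha _ _ hc)

/-- The weight `|m|` of the generator with index `(m, j)`. -/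
noncomputable def idxWeight (p : Idx n) : ℤ := p.1.1.degree

section Generators

variable {X : Idx n → Uloc n}

theorem letterFil_le_H (hX : ∀ p, X p ∈ H n) (d : ℤ) :
    letterFil ℂ X idxWeight d ≤ (H n).toSubmodule := by
  refine Submodule.span_le.2 ?_
  rintro _ ⟨l, -, rfl⟩
  refine (H n).list_prod_mem fun x hx => ?_
  obtain ⟨p, -, rfl⟩ := List.mem_map.1 hx
  exact hX p

/-- The comparison of filtrations behind spanning. Negative weights of ∂_i⁻¹ rule out an induction
on the weight of words; instead each generator is shown to raise `colFil` by at most its weight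
under right multiplication, and the result is applied to 1. -/
theorem mem_letterFil_of_mem_H (hX : ∀ p, X p ∈ H n)
    (hl : ∀ p, HasLeadingTerm p.1.1 p.1.2 (X p)) {d : ℤ} {u : Uloc n} (hu : u ∈ H n)
    (hd : u ∈ letterFil ℂ locGen ordWeight d) : u ∈ letterFil ℂ X idxWeight d := by
  set F := letterFil ℂ X idxWeight with hF
  have hF' : IsMulFil F := isMulFil_letterFil X idxWeight
  have hH : ∀ d, F d ≤ (H n).toSubmodule := letterFil_le_H hX
  set C := colFil F (List.finRange n) with hC
  have hS : IsMulFil (rightMulFil C) := isMulFil_rightMulFil (colFil_mono hF'.mono _)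
  have hT : ∀ i, tElt i ∈ rightMulFil C 0 := fun i d c hc => by
    rw [add_zero]
    exact mul_tElt_mem_colFil hF'.mono _ (List.mem_finRange i) hc
  have hD : ∀ (i : Fin n) (k : ℤ), ((delUnit i ^ k : (Uloc n)ˣ) : Uloc n) ∈ rightMulFil C k :=
    fun i k d c hc => mul_zpow_mem_colFil _ (List.mem_finRange i) k hc
  have h1 : ∀ i : Fin n, (delUnit i : Uloc n) ∈ rightMulFil C 1 := fun i => by
    simpa using hD i 1
  have h2 : ∀ i : Fin n, ((delUnit i)⁻¹ : (Uloc n)ˣ).val ∈ rightMulFil C (-1) := fun i => by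
    simpa using hD i (-1)
  have h3 : ∀ i : Fin n, (hElt i : Uloc n) ∈ rightMulFil C 1 := fun i => by
    rw [hElt_eq]
    simpa using hS.mul_mem (hT i) (h1 i)
  have hXm : ∀ p, X p ∈ rightMulFil C (idxWeight p) := fun p d c hc =>
    mul_mem_colFil_of_commute _ (fun d c hc => hF'.mul_mem hc (letter_mem_letterFil p le_rfl))
      (fun i _ => commute_tElt_of_mem_H (hX p) i) (fun i _ => (mem_H_iff.1 (hX p)).1 i) hc
  -- Induction on |m|. The cases m = 0 and m = e_j are ∂_j and h_j = T_j ∂_j; in the others (*) is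
  -- solved for t^m∂_j.
  have hV : ∀ (N : ℕ) (m : Fin n →₀ ℕ) (j : Fin n), m.degree < N →
      toUloc (vf m j) ∈ rightMulFil C 1 := by
    intro N
    induction N with
    | zero => intro m j h; omega
    | succ N ih =>
      intro m j hm
      rcases eq_or_ne m (Finsupp.single j 1) with rfl | hmj
      · exact h3 j
      rcases Nat.eq_zero_or_pos m.degree with h0 | h0
      · rw [Finsupp.degree_eq_zero_iff] at h0
        rw [h0, ← val_delUnit]
        exact h1 j
      obtain ⟨g, hg, hgX⟩ := hl ⟨(m, j), h0, hmj⟩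
      dsimp only at hg hgX
      set a : Fin n → ℤ := fun k => (m k : ℤ) - (Finsupp.single j 1 k : ℕ) with ha
      have h4 : toUloc (vf m j) * delPow a ∈ rightMulFil C m.degree := by
        rw [← sub_eq_iff_eq_add] at hgX
        rw [← hgX]
        refine sub_mem (hXm ⟨(m, j), h0, hmj⟩)
          (Submodule.sum_mem _ fun d hd => Submodule.sum_mem _ fun r hr => ?_)
        rw [mem_range_finsuppAntidiag_iff] at hr
        subst hr
        have hd' := Finset.mem_range.1 hd
        have := hg r hd'
        exact term_mem hS h1 h2 h3 (ih r j (by omega)) _ (by omega)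
      -- Cancelling ∂^(m - e_j) subtracts |m| - 1 from the weight |m| and leaves 1.
      have h5 := hS.mul_mem h4 (hS.delPow_mem h1 h2 (-a))
      rw [mul_assoc, ← delPow_add, add_neg_cancel, delPow_zero, mul_one, mul_one] at h5
      refine hS.mono ?_ h5
      simp only [Pi.neg_apply, Finset.sum_neg_distrib, ha, sum_sub_single]
      omega
  have h6 : letterFil ℂ locGen ordWeight d ≤ rightMulFil C d := hS.letterFil_le (by
    rintro (⟨m, j⟩ | i)
    · exact hV _ m j (Nat.lt_succ_self _)
    · exact h2 i) d
  have h7 := h6 hd 0 1 (le_colFil _ _ hF'.one_mem)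
  rw [one_mul, zero_add] at h7
  exact mem_of_mem_colFil hH _ (List.nodup_finRange n) h7 hu

/-- The drop is known in the weights of U_∂; as the commutator lies in H_n, it transfers to words in
the X. -/
theorem commutator_mem_letterFil_idxWeight (hX : ∀ p, X p ∈ H n)
    (hl : ∀ p, HasLeadingTerm p.1.1 p.1.2 (X p)) (p q : Idx n) :
    X p * X q - X q * X p ∈ letterFil ℂ X idxWeight (idxWeight p + idxWeight q - 1) :=
  mem_letterFil_of_mem_H hX hl
    ((H n).sub_mem ((H n).mul_mem (hX p) (hX q)) ((H n).mul_mem (hX q) (hX p)))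
    (commutator_mem_letterFil isAdmissible_ordWeight.commutator_mem
      (mem_ordFil_of_hasLeadingTerm (hl p)) (mem_ordFil_of_hasLeadingTerm (hl q)) le_rfl)

theorem mem_span_words_of_mem_H (hX : ∀ p, X p ∈ H n)
    (hl : ∀ p, HasLeadingTerm p.1.1 p.1.2 (X p)) {σ : Type*} (L : σ → List (Idx n))
    (hL : ∀ l : List (Idx n), ∃ s, l.Perm (L s)) {u : Uloc n} (hu : u ∈ H n) :
    u ∈ Submodule.span ℂ (Set.range fun s => ((L s).map X).prod) := by
  obtain ⟨d, hd⟩ := exists_mem_ordFil u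
  refine letterFil_le_of_rearrange (commutator_mem_letterFil_idxWeight hX hl)
    (fun p => Int.natCast_nonneg _) (fun _ => Submodule.span ℂ (Set.range fun s => ((L s).map X).prod))
    (fun _ _ _ => le_rfl) (fun l => ?_) d (mem_letterFil_of_mem_H hX hl hu hd)
  obtain ⟨s, hs⟩ := hL l
  exact ⟨L s, hs, Submodule.subset_span ⟨s, rfl⟩⟩

end Generators

end WittLoc

namespace WittLoc

/-! ### Independence of words in the enveloping algebra of the Witt algebra -/

section WittPBW

variable {n : ℕ}

attribute [local instance] LieRing.ofAssociativeRing

variable (n) in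
/-- The action of the enveloping algebra on polynomials. -/
noncomputable def polyAction : U n →ₐ[ℂ] Module.End ℂ (MvPolynomial (Fin n) ℂ) :=
  UniversalEnvelopingAlgebra.lift ℂ
    { toFun := fun D => (D : MvPolynomial (Fin n) ℂ →ₗ[ℂ] MvPolynomial (Fin n) ℂ)
      map_add' := fun _ _ => rfl
      map_smul' := fun _ _ => rfl
      map_lie' := fun {D E} => by
        ext1 f
        rfl }

theorem polyAction_ι (D : W n) (f : MvPolynomial (Fin n) ℂ) :
    polyAction n (UniversalEnvelopingAlgebra.ι ℂ D) f = D f := by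
  rw [polyAction, UniversalEnvelopingAlgebra.lift_ι_apply]
  rfl

/-- A functional on the enveloping algebra that reads off the coefficient of `t^m ∂_j` of a vector
field and vanishes at `1`. -/
noncomputable def vfFunctional (p : (Fin n →₀ ℕ) × Fin n) : U n →ₗ[ℂ] ℂ :=
  MvPolynomial.lcoeff ℂ p.1 ∘ₗ LinearMap.applyₗ (MvPolynomial.X p.2) ∘ₗ
      (polyAction n).toLinearMap -
    (if p.1 = Finsupp.single p.2 1 then (1 : ℂ) else 0) •
      MvPolynomial.lcoeff ℂ 0 ∘ₗ LinearMap.applyₗ 1 ∘ₗ (polyAction n).toLinearMap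

theorem vfFunctional_apply (p : (Fin n →₀ ℕ) × Fin n) (u : U n) :
    vfFunctional p u = (polyAction n u (MvPolynomial.X p.2)).coeff p.1 -
      (if p.1 = Finsupp.single p.2 1 then (1 : ℂ) else 0) * (polyAction n u 1).coeff 0 := rfl

theorem vfFunctional_one (p : (Fin n →₀ ℕ) × Fin n) : vfFunctional p 1 = 0 := by
  rw [vfFunctional_apply, map_one, Module.End.one_apply, Module.End.one_apply,
    MvPolynomial.coeff_zero_one, mul_one, MvPolynomial.coeff_X, sub_eq_zero]
  simp only [eq_comm]

/-- A vector field kills 1, so the term correcting the value at 1 does not contribute, and its value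
at t_j is its j-th component. -/
theorem vfFunctional_vf (p q : (Fin n →₀ ℕ) × Fin n) :
    vfFunctional p (UniversalEnvelopingAlgebra.ι ℂ (vf q.1 q.2 : W n)) = if p = q then 1 else 0 := by
  rw [vfFunctional_apply, polyAction_ι, polyAction_ι, Derivation.map_one_eq_zero,
    MvPolynomial.coeff_zero, mul_zero, sub_zero, vf_apply_X, apply_ite (MvPolynomial.coeff p.1),
    MvPolynomial.coeff_zero, MvPolynomial.coeff_monomial, ← ite_and]
  refine if_congr ?_ rfl rfl
  rw [Prod.ext_iff, and_comm, eq_comm, @eq_comm _ p.2]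

/-- The word in `U(W_n)` attached to a list of indices of vector fields `t^m ∂_j`. -/
noncomputable def vfWord (l : List ((Fin n →₀ ℕ) × Fin n)) : U n :=
  envWord (K := ℂ) (fun p : (Fin n →₀ ℕ) × Fin n => (vf p.1 p.2 : W n)) l

theorem linearIndependent_vfWord {σ : Type*} (l : σ → List ((Fin n →₀ ℕ) × Fin n))
    (hl : ∀ s s', (l s).Perm (l s') → s = s') : LinearIndependent ℂ fun s => vfWord (l s) :=
  linearIndependent_envWord _ vfFunctional vfFunctional_one vfFunctional_vf l hl

/-- The generators `t^m ∂_j` of `U(W_n)`. -/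
noncomputable def envGen (p : (Fin n →₀ ℕ) × Fin n) : U n :=
  UniversalEnvelopingAlgebra.ι ℂ (vf p.1 p.2 : W n)

theorem vfWord_eq (l : List ((Fin n →₀ ℕ) × Fin n)) : vfWord l = (l.map envGen).prod := rfl

theorem vfWord_append (k l : List ((Fin n →₀ ℕ) × Fin n)) :
    vfWord (k ++ l) = vfWord k * vfWord l := by
  simp [vfWord_eq]

theorem IsAdmissible.commutator_envGen_mem {w : ((Fin n →₀ ℕ) × Fin n) ⊕ Fin n → ℤ}
    (hw : IsAdmissible w) (p q : (Fin n →₀ ℕ) × Fin n) :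
    envGen p * envGen q - envGen q * envGen p ∈
      letterFil ℂ envGen (w ∘ Sum.inl) (w (.inl p) + w (.inl q) - 1) := by
  have h1 : envGen p * envGen q - envGen q * envGen p =
      UniversalEnvelopingAlgebra.ι ℂ ⁅(vf p.1 p.2 : W n), vf q.1 q.2⁆ := by
    rw [LieHom.map_lie, LieRing.of_associative_ring_bracket]
    rfl
  rw [h1]
  refine (Submodule.span_le (p := (letterFil ℂ envGen (w ∘ Sum.inl) _).comap
    (UniversalEnvelopingAlgebra.ι ℂ : W n →ₗ⁅ℂ⁆ U n).toLinearMap)).2 ?_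
    (hw.bracket_vf_mem_span p q)
  rintro _ ⟨r, hr, rfl⟩
  exact letter_mem_letterFil (x := envGen) r hr

/-- Words of the same weight `d`, not rearrangements of each other, are linearly independent modulo
the words of smaller weight. -/
theorem eq_zero_of_sum_vfWord_mem {w : ((Fin n →₀ ℕ) × Fin n) ⊕ Fin n → ℤ} (hw : IsAdmissible w)
    (hw0 : ∀ p, 0 ≤ w (.inl p)) {τ : Type*} [Fintype τ] (c : τ → ℂ)
    (l : τ → List ((Fin n →₀ ℕ) × Fin n)) (d : ℤ)
    (hd : ∀ s, ((l s).map (w ∘ Sum.inl)).sum = d) (hl : ∀ s s', (l s).Perm (l s') → s = s')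
    (h : ∑ s, c s • vfWord (l s) ∈ letterFil ℂ envGen (w ∘ Sum.inl) (d - 1)) (s : τ) : c s = 0 := by
  -- One word per multiset of weight at most d - 1 spans the smaller filtration step; together with
  -- the given words these remain pairwise not rearrangements.
  let σ := {M : Multiset ((Fin n →₀ ℕ) × Fin n) // (M.map (w ∘ Sum.inl)).sum ≤ d - 1}
  let L : τ ⊕ σ → List ((Fin n →₀ ℕ) × Fin n) := Sum.elim l fun M => M.1.toList
  have hM : ∀ M : Multiset ((Fin n →₀ ℕ) × Fin n),
      (M.toList.map (w ∘ Sum.inl)).sum = (M.map (w ∘ Sum.inl)).sum := fun M => by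
    conv_rhs => rw [← M.coe_toList, Multiset.map_coe, Multiset.sum_coe]
  have hne : ∀ (t : τ) (M : σ), ¬ (l t).Perm M.1.toList := fun t M hp => by
    have h1 := (hp.map (w ∘ Sum.inl)).sum_eq
    rw [hd, hM] at h1
    have := M.2
    omega
  have hL : ∀ a b, (L a).Perm (L b) → a = b := by
    rintro (a | a) (b | b) hp
    · exact congrArg _ (hl a b hp)
    · exact absurd hp (hne a b)
    · exact absurd hp.symm (hne b a)
    · refine congrArg _ (Subtype.ext ?_)
      rw [← a.1.coe_toList, ← b.1.coe_toList]
      exact Multiset.coe_eq_coe.2 hp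
  obtain ⟨h1, -, h2⟩ := linearIndependent_sum.1 (linearIndependent_vfWord L hL)
  have h3 : letterFil ℂ envGen (w ∘ Sum.inl) (d - 1) ≤
      Submodule.span ℂ (Set.range ((fun a => vfWord (L a)) ∘ Sum.inr)) := by
    refine (letterFil_le_of_rearrange hw.commutator_envGen_mem hw0
      (fun e => Submodule.span ℂ {z | ∃ M : Multiset ((Fin n →₀ ℕ) × Fin n),
        (M.map (w ∘ Sum.inl)).sum ≤ e ∧ vfWord M.toList = z}) ?_ ?_ (d - 1)).trans ?_
    · exact fun e f hef => Submodule.span_mono fun z ⟨M, hM, hz⟩ => ⟨M, hM.trans hef, hz⟩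
    · intro k
      refine ⟨(k : Multiset _).toList, Multiset.coe_eq_coe.1 (Multiset.coe_toList _).symm,
        Submodule.subset_span ⟨k, ?_, rfl⟩⟩
      exact (hM _).ge
    · refine Submodule.span_mono ?_
      rintro z ⟨M, hM, rfl⟩
      exact ⟨⟨M, hM⟩, rfl⟩
  have h4 : ∑ s, c s • vfWord (l s) = 0 := by
    refine Submodule.disjoint_def.1 h2 _ (Submodule.sum_mem _ fun s _ => Submodule.smul_mem _ _
      (Submodule.subset_span ⟨s, rfl⟩)) (h3 h)
  exact Fintype.linearIndependent_iff.1 h1 c h4 s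

end WittPBW

/-! ### Clearing denominators -/

section Denominators

variable {n : ℕ}

theorem delMonoid_mul_comm {s t : U n} (hs : s ∈ delMonoid n) (ht : t ∈ delMonoid n) :
    s * t = t * s := by
  have h : ∀ a ∈ Set.range (del (n := n)), ∀ b ∈ Set.range (del (n := n)), a * b = b * a := by
    rintro _ ⟨i, rfl⟩ _ ⟨j, rfl⟩
    have h1 := del_mul_sub i (MvPolynomial.pderiv j : W n)
    rw [pderiv_eq_vf, pderiv_eq_vf, bracket_vf, Finsupp.coe_zero, Pi.zero_apply, Pi.zero_apply,
      Nat.cast_zero, zero_smul, zero_smul, sub_zero, UniversalEnvelopingAlgebra.ι_apply,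
      UniversalEnvelopingAlgebra.ι_apply, map_zero, map_zero, adHom_apply, sub_eq_zero,
      ← pderiv_eq_vf] at h1
    exact h1
  have := Submonoid.isMulCommutative_closure _ h
  exact congrArg Subtype.val (IsMulCommutative.is_comm.comm
    (⟨s, hs⟩ : Submonoid.closure (Set.range (del (n := n)))) ⟨t, ht⟩)

theorem exists_vfWord_eq_of_mem_delMonoid {s : U n} (hs : s ∈ delMonoid n) :
    ∃ k : List (Fin n), s = vfWord (k.map fun i => ((0 : Fin n →₀ ℕ), i)) := by
  induction hs using Submonoid.closure_induction with
  | mem s hs =>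
    obtain ⟨i, rfl⟩ := hs
    refine ⟨[i], ?_⟩
    rw [del, pderiv_eq_vf]
    simp [vfWord_eq, envGen]
  | one => exact ⟨[], by simp [vfWord_eq]⟩
  | mul x y _ _ hx hy =>
    obtain ⟨k, rfl⟩ := hx
    obtain ⟨l, rfl⟩ := hy
    exact ⟨k ++ l, by rw [List.map_append, vfWord_append]⟩

theorem num_del (i : Fin n) : num n (del i) = delUnit i := rfl

theorem num_vfWord (l : List ((Fin n →₀ ℕ) × Fin n)) :
    num n (vfWord l) = (l.map fun p => toUloc (vf p.1 p.2)).prod := by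
  rw [vfWord_eq, map_list_prod, List.map_map]
  rfl

theorem exists_num_eq_delPow (q : Fin n → ℕ) :
    ∃ g ∈ delMonoid n, num n g = delPow fun i => (q i : ℤ) := by
  refine ⟨(List.ofFn fun i => del i ^ q i).prod, Submonoid.list_prod_mem _ fun x hx => ?_, ?_⟩
  · obtain ⟨i, rfl⟩ := List.mem_ofFn.1 hx
    exact (delMonoid n).pow_mem (Submonoid.subset_closure ⟨i, rfl⟩) _
  · rw [map_list_prod, List.map_ofFn, delPow, ← Units.coeHom_apply, map_list_prod, List.map_ofFn]
    congr 2
    funext i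
    simp [num_del]

theorem exists_mul_eq_of_num_eq {a b : U n} (h : num n a = num n b) :
    ∃ s ∈ delMonoid n, s * a = s * b := by
  obtain ⟨u, v, h1, h2⟩ := OreLocalization.oreDiv_eq_iff.1 (show a /ₒ (1 : delMonoid n) = b /ₒ (1 : delMonoid n) from h)
  rw [Submonoid.coe_one, mul_one, mul_one] at h2
  rw [← h2] at h1
  exact ⟨u, u.2, h1.symm⟩

/-- Weights on the generators for which a generator of index `(m, j)` has leading term of weight
`2|m|`. -/
noncomputable def degWeight : ((Fin n →₀ ℕ) × Fin n) ⊕ Fin n → ℤ :=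
  Sum.elim (fun p => if p.1 = Finsupp.single p.2 1 then 1 else 2 * p.1.degree) fun _ => 0

theorem degWeight_inl (m : Fin n →₀ ℕ) (j : Fin n) :
    degWeight (.inl (m, j)) = if m = Finsupp.single j 1 then 1 else 2 * (m.degree : ℤ) := rfl

theorem degWeight_inl_le (m : Fin n →₀ ℕ) (j : Fin n) :
    degWeight (.inl (m, j)) ≤ 2 * m.degree := by
  rw [degWeight_inl]
  split_ifs with h
  · rw [h, Finsupp.degree_single]
    norm_num
  · exact le_rfl

theorem degWeight_zero (j : Fin n) : degWeight (.inl ((0 : Fin n →₀ ℕ), j)) = 0 := by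
  have h := degWeight_inl_le (0 : Fin n →₀ ℕ) j
  rw [degWeight_inl] at h ⊢
  split_ifs at h ⊢ <;> simp at h ⊢

theorem degWeight_nonneg (p : (Fin n →₀ ℕ) × Fin n) : 0 ≤ degWeight (.inl p) := by
  rw [degWeight_inl]
  split_ifs <;> omega

/-- If one factor is h_i, of weight 1, the other field keeps its weight. Otherwise the degrees
satisfy |m + s - e_i| = |m| + |s| - 1, so the doubled degree drops by 2. -/
theorem isAdmissible_degWeight : IsAdmissible (degWeight (n := n)) where
  bracket m s i j hs h := by
    by_cases hm : m = Finsupp.single i 1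
    · rw [hm, add_tsub_cancel_left, degWeight_inl (Finsupp.single i 1), if_pos rfl]
      omega
    by_cases hs' : s = Finsupp.single j 1
    · subst hs'
      have hij : i = j := by
        by_contra hij
        exact hs (Finsupp.single_eq_of_ne hij)
      subst hij
      rw [add_tsub_cancel_right, degWeight_inl (Finsupp.single i 1), if_pos rfl]
      omega
    · have h1 := degWeight_inl_le (m + s - Finsupp.single i 1) j
      have h2 : (m + s - Finsupp.single i 1).degree + 1 = m.degree + s.degree := by
        have h3 : Finsupp.single i 1 ≤ m + s :=
          le_add_left (Finsupp.single_le_iff.2 (Nat.one_le_iff_ne_zero.2 hs))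
        have h4 := congrArg Finsupp.degree (tsub_add_cancel_of_le h3)
        rwa [map_add, Finsupp.degree_single, map_add] at h4
      rw [degWeight_inl m, if_neg hm, degWeight_inl s, if_neg hs']
      omega
  inv i := by rw [degWeight_zero]; rfl

/-- The inverses are moved to the front, where a product of the ∂_i on the left cancels them. They
have weight 0, so the weight is unchanged. -/
theorem exists_rearrange_locGen (l : List (((Fin n →₀ ℕ) × Fin n) ⊕ Fin n)) :
    ∃ l', l.Perm l' ∧ ∃ s ∈ delMonoid n, ∃ k : List ((Fin n →₀ ℕ) × Fin n),
      (k.map (degWeight ∘ Sum.inl)).sum = (l'.map degWeight).sum ∧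
      num n s * (l'.map locGen).prod = num n (vfWord k) := by
  induction l with
  | nil => exact ⟨[], List.Perm.refl _, 1, one_mem _, [], rfl, by simp [vfWord_eq]⟩
  | cons a l ih =>
    obtain ⟨l', hp, s, hs, k, hk, he⟩ := ih
    rcases a with p | i
    · refine ⟨l' ++ [Sum.inl p], (hp.cons _).trans (List.perm_append_singleton _ _).symm, s, hs,
        k ++ [p], by simp [hk], ?_⟩
      rw [List.map_append, List.prod_append, ← mul_assoc, he, vfWord_append, map_mul]
      simp [num_vfWord, locGen]
    · refine ⟨Sum.inr i :: l', hp.cons _, s * del i,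
        mul_mem hs (Submonoid.subset_closure ⟨i, rfl⟩), k, ?_, ?_⟩
      · rw [List.map_cons, List.sum_cons, hk]
        exact (zero_add _).symm
      · rw [List.map_cons, List.prod_cons, map_mul, num_del, ← he]
        change num n s * (delUnit i : Uloc n) * (((delUnit i)⁻¹ : (Uloc n)ˣ) * _) = _
        rw [mul_assoc, Units.mul_inv_cancel_left]

theorem mem_degFil_of_mem_delMonoid {s : U n} (hs : s ∈ delMonoid n) :
    s ∈ letterFil ℂ envGen (degWeight ∘ Sum.inl) 0 := by
  obtain ⟨k, rfl⟩ := exists_vfWord_eq_of_mem_delMonoid hs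
  refine prod_mem_letterFil _ (le_of_eq ?_)
  rw [List.map_map]
  refine List.sum_eq_zero fun z hz => ?_
  obtain ⟨i, -, rfl⟩ := List.mem_map.1 hz
  exact degWeight_zero i

theorem mul_mem_degFil_of_mem_delMonoid {s f : U n} {d : ℤ} (hs : s ∈ delMonoid n)
    (hf : f ∈ letterFil ℂ envGen (degWeight ∘ Sum.inl) d) :
    s * f ∈ letterFil ℂ envGen (degWeight ∘ Sum.inl) d :=
  mul_mem_letterFil (mem_degFil_of_mem_delMonoid hs) hf (zero_add d).le

/-- The elements of the localization that become elements of weight at most `d` of `U(W_n)` after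
multiplication by a product of the `∂_i`. -/
noncomputable def clearFil (n : ℕ) (d : ℤ) : Submodule ℂ (Uloc n) where
  carrier := {r | ∃ s ∈ delMonoid n, ∃ f ∈ letterFil ℂ envGen (degWeight ∘ Sum.inl) d,
    num n s * r = num n f}
  zero_mem' := ⟨1, one_mem _, 0, zero_mem _, by rw [mul_zero, map_zero]⟩
  add_mem' := by
    rintro a b ⟨s, hs, f, hf, h1⟩ ⟨t, ht, g, hg, h2⟩
    refine ⟨s * t, mul_mem hs ht, t * f + s * g, add_mem (mul_mem_degFil_of_mem_delMonoid ht hf)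
      (mul_mem_degFil_of_mem_delMonoid hs hg), ?_⟩
    rw [mul_add, map_add, map_mul (num n) t f, map_mul (num n) s g, ← h1, ← h2, ← mul_assoc,
      ← mul_assoc, ← map_mul, ← map_mul, delMonoid_mul_comm hs ht]
  smul_mem' := by
    rintro c a ⟨s, hs, f, hf, h1⟩
    exact ⟨s, hs, c • f, Submodule.smul_mem _ _ hf, by rw [mul_smul_comm, h1, map_smul]⟩

theorem letterFil_le_clearFil (d : ℤ) : letterFil ℂ locGen degWeight d ≤ clearFil n d := by
  refine letterFil_le_of_rearrange isAdmissible_degWeight.commutator_mem ?_ (clearFil n) ?_ ?_ d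
  · rintro (p | i)
    · exact degWeight_nonneg p
    · exact le_rfl
  · rintro d e hde r ⟨s, hs, f, hf, h⟩
    exact ⟨s, hs, f, letterFil_mono hde hf, h⟩
  · intro l
    obtain ⟨l', hp, s, hs, k, hk, he⟩ := exists_rearrange_locGen l
    exact ⟨l', hp, s, hs, _, prod_mem_letterFil k hk.le, he⟩

end Denominators

end WittLoc

namespace WittLoc

variable {n : ℕ}

/-! ### Independence of the words in the generators -/

/-- The pair `(m, j)` underlying an index. -/
def idxPair (p : Idx n) : (Fin n →₀ ℕ) × Fin n := p.1

theorem idxPair_injective : Function.Injective (idxPair (n := n)) := Subtype.val_injective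

/-- The weight in `degWeight` of the leading term of the generator with index `p`. -/
noncomputable def leadWeight (p : Idx n) : ℤ := degWeight (.inl p.1)

theorem leadWeight_eq (p : Idx n) : leadWeight p = 2 * p.1.1.degree := if_neg p.2.2

theorem delPow_mem_degFil (a : Fin n → ℤ) : delPow a ∈ letterFil ℂ locGen degWeight 0 := by
  have h := (isMulFil_letterFil (locGen (n := n)) degWeight).delPow_mem (κ := 0)
    (fun i => by
      rw [val_delUnit]
      exact letter_mem_letterFil (x := locGen) (Sum.inl (0, i)) (degWeight_zero i).le)
    (fun i => letter_mem_letterFil (x := locGen) (Sum.inr i) le_rfl) a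
  rwa [mul_zero] at h

theorem vf_mem_degFil (m : Fin n →₀ ℕ) (j : Fin n) :
    toUloc (vf m j) ∈ letterFil ℂ locGen degWeight (2 * m.degree) :=
  letter_mem_letterFil (x := locGen) (Sum.inl (m, j)) (degWeight_inl_le m j)

/-- The power of ∂ is moved to the left, ready for clearing denominators, at the cost of a
commutator of smaller weight. The remaining terms have weight at most 2|r| + (|m| - |r|) < 2|m|. -/
theorem sub_leading_mem_degFil {m : Fin n →₀ ℕ} {j : Fin n} {x : Uloc n}
    (hx : HasLeadingTerm m j x) :
    x - delPow (fun k => (m k : ℤ) - (Finsupp.single j 1 k : ℕ)) * toUloc (vf m j) ∈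
      letterFil ℂ locGen degWeight (2 * m.degree - 1) := by
  have hS := isMulFil_letterFil (locGen (n := n)) degWeight
  obtain ⟨g, hg, rfl⟩ := hx
  rw [add_sub_right_comm]
  refine add_mem (commutator_mem_letterFil isAdmissible_degWeight.commutator_mem
    (vf_mem_degFil m j) (delPow_mem_degFil _) (by omega))
    (Submodule.sum_mem _ fun d hd => Submodule.sum_mem _ fun r hr => ?_)
  rw [mem_range_finsuppAntidiag_iff] at hr
  subst hr
  have hd' := Finset.mem_range.1 hd
  have := hg r hd'
  have h3 : ∀ i : Fin n, (hElt i : Uloc n) ∈ letterFil ℂ locGen degWeight 1 := fun i =>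
    letter_mem_letterFil (x := locGen) (Sum.inl (Finsupp.single i 1, i)) (if_pos rfl).le
  have h4 := hS.mul_mem (hS.mul_mem (vf_mem_degFil r j) (hS.polyH_mem h3 (g r)))
    (delPow_mem_degFil fun k => (r k : ℤ) - (Finsupp.single j 1 k : ℕ))
  exact hS.mono (by omega) h4

theorem exists_word_sub_leading_mem_degFil {X : Idx n → Uloc n}
    (hl : ∀ p, HasLeadingTerm p.1.1 p.1.2 (X p)) (l : List (Idx n)) :
    ∃ a : Fin n → ℤ, (l.map X).prod - delPow a * num n (vfWord (l.map idxPair)) ∈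
      letterFil ℂ locGen degWeight ((l.map leadWeight).sum - 1) := by
  have hS := isMulFil_letterFil (locGen (n := n)) degWeight
  induction l with
  | nil =>
    refine ⟨0, ?_⟩
    rw [delPow_zero, List.map_nil, List.map_nil, vfWord_eq, List.map_nil]
    simp
  | cons p l ih =>
    obtain ⟨b, hb⟩ := ih
    set a : Fin n → ℤ := fun k => (p.1.1 k : ℤ) - (Finsupp.single p.1.2 1 k : ℕ)
    set v : Uloc n := toUloc (vf p.1.1 p.1.2)
    set V : Uloc n := num n (vfWord (l.map idxPair)) with hV
    set Y : Uloc n := (l.map X).prod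
    set d := (l.map leadWeight).sum with hd
    have hv : v ∈ letterFil ℂ locGen degWeight (leadWeight p) := by
      rw [leadWeight_eq]
      exact vf_mem_degFil _ _
    have hXp : X p - delPow a * v ∈ letterFil ℂ locGen degWeight (leadWeight p - 1) := by
      rw [leadWeight_eq]
      exact sub_leading_mem_degFil (hl p)
    have hVm : V ∈ letterFil ℂ locGen degWeight d := by
      rw [hV, num_vfWord, hd]
      have := prod_mem_letterFil (R := ℂ) (x := locGen) (w := degWeight)
        (l.map fun p => (Sum.inl p.1 : ((Fin n →₀ ℕ) × Fin n) ⊕ Fin n)) le_rfl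
      rw [List.map_map, List.map_map] at this
      rw [List.map_map]
      exact this
    have hY : Y ∈ letterFil ℂ locGen degWeight d := by
      have h1 := hS.mul_mem (delPow_mem_degFil b) hVm
      rw [zero_add] at h1
      have h2 := add_mem (hS.mono (by omega) hb) h1
      rwa [sub_add_cancel] at h2
    refine ⟨a + b, ?_⟩
    have h3 : num n (vfWord ((p :: l).map idxPair)) = v * V := by
      rw [hV, num_vfWord, num_vfWord]
      rfl
    -- Replace `X p` by its leading term, then `Y`, then move ∂^b to the left past `v`; each
    -- replacement costs weight one.
    have h4 : X p * Y - delPow (a + b) * (v * V) = (X p - delPow a * v) * Y +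
        delPow a * v * (Y - delPow b * V) + delPow a * (v * delPow b - delPow b * v) * V := by
      rw [delPow_add]
      noncomm_ring
    rw [h3, List.map_cons, List.map_cons, List.prod_cons, List.sum_cons, h4]
    have h5 := commutator_mem_letterFil isAdmissible_degWeight.commutator_mem hv
      (delPow_mem_degFil b) le_rfl
    refine add_mem (add_mem ?_ ?_) ?_
    · exact hS.mono (by omega) (hS.mul_mem hXp hY)
    · exact hS.mono (by omega) (hS.mul_mem (hS.mul_mem (delPow_mem_degFil a) hv) hb)
    · exact hS.mono (by omega) (hS.mul_mem (hS.mul_mem (delPow_mem_degFil a) h5) hVm)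

theorem filter_append_map_zero (k : List (Fin n)) (l : List (Idx n)) :
    ((k.map fun i => ((0 : Fin n →₀ ℕ), i)) ++ l.map idxPair).filter (fun p => p.1 ≠ 0) =
      l.map idxPair := by
  rw [List.filter_append, List.filter_eq_nil_iff.2, List.nil_append, List.filter_eq_self]
  · intro p hp
    obtain ⟨q, -, rfl⟩ := List.mem_map.1 hp
    have h : 1 ≤ (idxPair q).1.degree := q.2.1
    simp only [ne_eq, decide_eq_true_eq]
    intro h0
    rw [h0, map_zero] at h
    omega
  · intro p hp
    obtain ⟨i, -, rfl⟩ := List.mem_map.1 hp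
    simp

/-- Combinations of words of the same weight in the leading terms that have smaller weight are
trivial. -/
theorem eq_zero_of_sum_leading_mem_degFil {τ : Type*} [Fintype τ] (c : τ → ℂ)
    (l : τ → List (Idx n)) (a : τ → Fin n → ℤ) (d : ℤ) (hd : ∀ s, ((l s).map leadWeight).sum = d)
    (hl : ∀ s s', (l s).Perm (l s') → s = s')
    (h : ∑ s, c s • (delPow (a s) * num n (vfWord ((l s).map idxPair))) ∈
      letterFil ℂ locGen degWeight (d - 1)) (s : τ) : c s = 0 := by
  obtain ⟨t, ht, f, hf, htf⟩ := letterFil_le_clearFil _ h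
  -- A common exponent large enough that N + a_s is nonnegative for every `s`.
  set N : Fin n → ℕ := fun i => ∑ s, (a s i).natAbs with hN
  obtain ⟨u, hu, huN⟩ := exists_num_eq_delPow N
  have h1 : ∀ s, ∃ g ∈ delMonoid n, num n g = num n u * delPow (a s) := by
    intro s
    obtain ⟨g, hg, hgN⟩ := exists_num_eq_delPow fun i => ((N i : ℤ) + a s i).toNat
    refine ⟨g, hg, ?_⟩
    rw [hgN, huN, ← delPow_add]
    congr 1
    funext i
    have : (a s i).natAbs ≤ N i :=
      Finset.single_le_sum (f := fun s => (a s i).natAbs) (fun _ _ => Nat.zero_le _)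
        (Finset.mem_univ s)
    simp only [Pi.add_apply]
    omega
  choose g hg hgu using h1
  have h2 : num n (t * ∑ s, c s • (g s * vfWord ((l s).map idxPair))) = num n (u * f) := by
    rw [map_mul (num n) u, ← htf, ← mul_assoc, ← map_mul, ← delMonoid_mul_comm ht hu, map_mul,
      map_mul, mul_assoc, Finset.mul_sum, map_sum]
    refine congrArg _ (Finset.sum_congr rfl fun s _ => ?_)
    rw [map_smul, map_mul, hgu, mul_smul_comm, mul_assoc]
  -- Equality in the localization descends to U(W_n) after one more multiplication by a denominator.
  obtain ⟨r, hr, hrt⟩ := exists_mul_eq_of_num_eq h2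
  choose k hk using fun s => exists_vfWord_eq_of_mem_delMonoid (mul_mem hr (mul_mem ht (hg s)))
  have h3 : ∑ s, c s • vfWord ((k s).map (fun i => ((0 : Fin n →₀ ℕ), i)) ++
      (l s).map idxPair) = r * (u * f) := by
    rw [← hrt, Finset.mul_sum, Finset.mul_sum]
    refine Finset.sum_congr rfl fun s _ => ?_
    rw [vfWord_append, ← hk, mul_smul_comm, mul_smul_comm]
    simp only [mul_assoc]
  refine eq_zero_of_sum_vfWord_mem isAdmissible_degWeight degWeight_nonneg c _ d (fun s => ?_)
    (fun s s' hp => hl s s' ?_) (h3 ▸ mul_mem_degFil_of_mem_delMonoid hr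
      (mul_mem_degFil_of_mem_delMonoid hu hf)) s
  · rw [List.map_append, List.sum_append, List.map_map, List.map_map, ← hd s,
      List.sum_eq_zero fun z hz => ?_, zero_add]
    · rfl
    · obtain ⟨i, -, rfl⟩ := List.mem_map.1 hz
      exact degWeight_zero i
  -- Discarding the letters ∂_i recovers the original words, since every index has |m| ≥ 1.
  · have h4 := hp.filter fun p => p.1 ≠ 0
    rw [filter_append_map_zero, filter_append_map_zero] at h4
    exact (List.map_perm_map_iff idxPair_injective).1 h4

/-- Among the words with nonzero coefficient take those of maximal weight `d`. The rest of the
relation has smaller weight, so the leading terms of these words combine to something of weight at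
most d - 1. -/
theorem linearIndependent_words {X : Idx n → Uloc n}
    (hl : ∀ p, HasLeadingTerm p.1.1 p.1.2 (X p)) {σ : Type*} (L : σ → List (Idx n))
    (hL : ∀ s s', (L s).Perm (L s') → s = s') :
    LinearIndependent ℂ fun s => ((L s).map X).prod := by
  classical
  have hS := isMulFil_letterFil (locGen (n := n)) degWeight
  rw [linearIndependent_iff']
  intro t c hc s hs
  by_contra hne
  obtain ⟨m, hm, hmax⟩ := (t.filter fun s => c s ≠ 0).exists_max_image
    (fun s => ((L s).map leadWeight).sum) ⟨s, by simp [hs, hne]⟩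
  rw [Finset.mem_filter] at hm
  choose a ha using fun s => exists_word_sub_leading_mem_degFil hl (L s)
  set d := ((L m).map leadWeight).sum with hd
  set T := t.filter fun s => ((L s).map leadWeight).sum = d with hT
  have hsmall : ∀ s ∈ t, c s ≠ 0 → ((L s).map leadWeight).sum ≠ d →
      ((L s).map leadWeight).sum ≤ d - 1 := fun s hs h0 h1 => by
    have := hmax s (by simp [hs, h0])
    omega
  have hword : ∀ s, ((L s).map X).prod ∈
      letterFil ℂ locGen degWeight ((L s).map leadWeight).sum := by
    intro s
    refine hS.list_prod_mem (fun p => ?_) _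
    have h1 := hS.mul_mem (delPow_mem_degFil fun k => (p.1.1 k : ℤ) - (Finsupp.single p.1.2 1 k : ℕ))
      (vf_mem_degFil p.1.1 p.1.2)
    rw [zero_add] at h1
    have h2 := add_mem (hS.mono (by omega) (sub_leading_mem_degFil (hl p))) h1
    rw [sub_add_cancel] at h2
    rw [leadWeight_eq]
    exact h2
  have h1 : ∑ s ∈ T, c s • (delPow (a s) * num n (vfWord ((L s).map idxPair))) ∈
      letterFil ℂ locGen degWeight (d - 1) := by
    have h2 : ∑ s ∈ T, c s • ((L s).map X).prod ∈ letterFil ℂ locGen degWeight (d - 1) := by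
      rw [← Finset.sum_filter_add_sum_filter_not t fun s => ((L s).map leadWeight).sum = d] at hc
      rw [eq_neg_of_add_eq_zero_left hc]
      refine neg_mem (Submodule.sum_mem _ fun s hs => ?_)
      rw [Finset.mem_filter] at hs
      by_cases h0 : c s = 0
      · rw [h0, zero_smul]
        exact zero_mem _
      · exact Submodule.smul_mem _ _ (hS.mono (hsmall s hs.1 h0 hs.2) (hword s))
    have h3 : ∑ s ∈ T, c s • (((L s).map X).prod -
        delPow (a s) * num n (vfWord ((L s).map idxPair))) ∈
        letterFil ℂ locGen degWeight (d - 1) := by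
      refine Submodule.sum_mem _ fun s hs => Submodule.smul_mem _ _ ?_
      have h4 := ha s
      rwa [(Finset.mem_filter.1 hs).2] at h4
    have h5 := sub_mem h2 h3
    rw [← Finset.sum_sub_distrib] at h5
    simpa only [← smul_sub, sub_sub_cancel] using h5
  rw [← Finset.sum_coe_sort T] at h1
  refine hm.2 (eq_zero_of_sum_leading_mem_degFil (fun s : T => c s) (fun s => L s) (fun s => a s) d
    (fun s => (Finset.mem_filter.1 s.2).2) (fun s s' hp => Subtype.ext (hL _ _ hp)) h1
    ⟨m, Finset.mem_filter.2 ⟨hm.1, rfl⟩⟩)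

/-! ### Ordered monomials as words -/

section OrderedMonomial

variable {ι : Type*} [LinearOrder ι]

/-- The word of the ordered monomial with exponents `s`. -/
def orderedWord (s : ι →₀ ℕ) : List ι :=
  (s.support.sort (· ≤ ·)).flatMap fun i => List.replicate (s i) i

theorem orderedMonomial_eq_prod {A : Type*} [Monoid A] (X : ι → A) (s : ι →₀ ℕ) :
    orderedMonomial X s = ((orderedWord s).map X).prod := by
  rw [orderedMonomial, orderedWord, List.map_flatMap, List.flatMap, List.prod_flatten, List.map_map]
  simp [Function.comp_def]

theorem count_orderedWord (s : ι →₀ ℕ) (i : ι) : (orderedWord s).count i = s i := by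
  have h : ∀ l : List ι, l.Nodup →
      (l.flatMap fun i => List.replicate (s i) i).count i = if i ∈ l then s i else 0 := by
    intro l hl
    induction l with
    | nil => simp
    | cons j l ih =>
      rw [List.nodup_cons] at hl
      rw [List.flatMap_cons, List.count_append, ih hl.2, List.count_replicate]
      rcases eq_or_ne j i with rfl | h
      · simp [hl.1]
      · simp [h, h.symm]
  rw [orderedWord, h _ (Finset.sort_nodup _ _)]
  simp only [Finset.mem_sort, Finsupp.mem_support_iff]
  split_ifs with h0
  · rfl
  · exact (not_not.1 h0).symm

theorem eq_of_orderedWord_perm (s t : ι →₀ ℕ) (h : (orderedWord s).Perm (orderedWord t)) :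
    s = t := by
  ext i
  rw [← count_orderedWord, ← count_orderedWord, h.count_eq]

theorem exists_perm_orderedWord (l : List ι) : ∃ s : ι →₀ ℕ, l.Perm (orderedWord s) := by
  refine ⟨Multiset.toFinsupp (l : Multiset ι), List.perm_iff_count.2 fun i => ?_⟩
  rw [count_orderedWord, Multiset.toFinsupp_apply, Multiset.coe_count]

end OrderedMonomial

end WittLoc

/-! ### The basis theorem -/

theorem corollary3p7 (n : ℕ) (hn : 0 < n) :
    (∃ X : WittLoc.Idx n → WittLoc.H n,
      ∀ p : WittLoc.Idx n, WittLoc.HasLeadingTerm p.1.1 p.1.2 (X p : WittLoc.Uloc n)) ∧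
    ∀ (_ : LinearOrder (WittLoc.Idx n)) (X : WittLoc.Idx n → WittLoc.H n),
      (∀ p : WittLoc.Idx n, WittLoc.HasLeadingTerm p.1.1 p.1.2 (X p : WittLoc.Uloc n)) →
      ∃ b : Module.Basis (WittLoc.Idx n →₀ ℕ) ℂ (WittLoc.H n),
        ∀ s : WittLoc.Idx n →₀ ℕ, b s = WittLoc.orderedMonomial X s := by
  refine ⟨?_, fun _ X hX => ?_⟩
  · choose x hxH hx using fun p : WittLoc.Idx n =>
      WittLoc.exists_mem_H_hasLeadingTerm p.1.1 p.1.2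
    exact ⟨fun p => ⟨x p, hxH p⟩, hx⟩
  -- Both properties are known for words in U_∂ and are pulled back along the inclusion of H_n.
  · have hval : ∀ s : WittLoc.Idx n →₀ ℕ,
        (WittLoc.H n).val.toLinearMap (WittLoc.orderedMonomial X s) =
          ((WittLoc.orderedWord s).map fun p => (X p : WittLoc.Uloc n)).prod := by
      intro s
      rw [WittLoc.orderedMonomial_eq_prod, AlgHom.toLinearMap_apply, map_list_prod, List.map_map]
      rfl
    have hli : LinearIndependent ℂ (WittLoc.orderedMonomial X) := by
      refine LinearIndependent.of_comp (WittLoc.H n).val.toLinearMap ?_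
      have h := WittLoc.linearIndependent_words hX WittLoc.orderedWord
        WittLoc.eq_of_orderedWord_perm
      rw [← funext hval] at h
      exact h
    have hsp : ⊤ ≤ Submodule.span ℂ (Set.range (WittLoc.orderedMonomial X)) := by
      intro u _
      have h := WittLoc.mem_span_words_of_mem_H (fun p => (X p).2) hX WittLoc.orderedWord
        WittLoc.exists_perm_orderedWord u.2
      rw [← funext hval, Set.range_comp' (WittLoc.H n).val.toLinearMap, ← Submodule.map_span] at h
      obtain ⟨v, hv, hvu⟩ := h
      rwa [show u = v from Subtype.ext hvu.symm]
    exact ⟨Module.Basis.mk hli hsp, fun s => Module.Basis.mk_apply hli hsp s⟩
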